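/- Let $p$ be a prime, $\zeta_p=e^{2\pi i/p}$, and let $G_p$ (resp. $H_p$) be the group of upper triangular $4\times4$ (resp. $3\times 3$) matrices over $\mathbb F_p$ with all diagonal entries $1$; write $E_{i,j}$ for the matrix that agrees with the identity except for a $1$ in position $(i,j)$. All representations are finite-dimensional and complex; $R(G)$ is the representation ring and $\lambda^i$ denotes the class of the $i$-th exterior power of a representation. Indices $i,j$ of basis vectors are read modulo $p$. **Notation.** For $a,b,c\in\mathbb F_p$ let $f_{(a,b,c)}\colon G_p\to\mathbb C^\times$, $g\mapsto \zeta_p^{a g_{12}+b g_{23}+c g_{34}}$. For $k\in\mathbb F_p^\times$ let $\phi_k\colon H_p\to \mathrm{GL}(p,\mathbb C)$ be the representation with $E_{1,2}e_j=e_{j+1}$, $E_{2,3}e_j=\zeta_p^{jk}e_j$. For $n,k\in\mathbb F_p$ not both $0$ put $$N_{nk^{-1}}=\left\{\begin{pmatrix}1&nx&ny&z\\0&1&0&-ky\\0&0&1&kx\\0&0&0&1\end{pmatrix} : x,y,z\in\mathbb F_p\right\},\qquad nk^{-1}\in\mathbb F_p\cup\{\infty\},$$ and let $H_\infty,H_0\cong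 H_p$ be the subgroups of $G_p$ embedded as the upper left and the lower right $3\times 3$ block. For $j\in\{0,\infty\}$, $\ell\in\mathbb{F}_p\cup\{\infty\}$, $\ell\ne j$, $i\in\mathbb F_p^\times$, let $\phi_{i,\ell,j}$ be the degree $p$ representation of $G_p$ inflated from $\phi_i$ along $G_p\to G_p/N_\ell\cong H_j\cong H_p$, and put $\phi_{i,\ell}=\phi_{i,\ell,\infty}$ for $\ell\neq\infty$, $\phi_{i,\infty}=\phi_{i,\infty,0}$. For $k\in\mathbb F_p^\times$ let $\psi_k$ be the degree $p^2$ representation of $G_p$ with basis $e_{i,j}$ ($i,j\in\mathbb F_p$) and $E_{1,2}e_{i,j}=e_{i,j+1}$, $E_{2,3}e_{i,j}=\zeta_p^{ijk}e_{i,j}$, $E_{3,4}e_{i,j}=e_{i+1,j}$. **General $p$.** $G_p$ is a Sylow $p$-subgroup of $\mathrm{GL}(4,p)$, and it has exactly $p(p-1)+p(p+1)(p-1)+p^3$ conjugacy classes. The $f_{(a,b,c)}$ are pairwise distinct and are all the homomorphisms $G_p\to\mathbb C^\times$, and $f_{(a,b,c)}\otimes f_{(a',b',c')}\cong f_{(a+a',b+b',c+c')}$.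 The kernel of $\phi_{i,\ell}$ is $N_\ell$; $\phi_{i,\ell,j}$ restricts to $\phi_i$ on $H_j$; and $\phi_{i,\ell,\infty}\cong\phi_{i\ell,\ell,0}$ for $\ell\ne0,\infty$. One has $f_{(a,b,c)}\otimes\phi_{i,nk^{-1}}\cong\phi_{i,nk^{-1}}$ if and only if $(a,b,c)=(kx,y,-nx)$ for some $x,y\in\mathbb F_p$, and $f_{(a,b,c)}\otimes\psi_k\cong\psi_k$ if and only if $b=0$; so the orbits of $\phi_{i,\ell}$ and of $\psi_k$ under tensoring with the $f_{(a,b,c)}$ have size $p$. The representations $$f_{(a,b,c)},\quad f_{(0,0,a)}\otimes\phi_{i,\ell}\ (\ell\in\mathbb F_p),\quad f_{(a,0,0)}\otimes\phi_{i,\infty},\quad f_{(0,a,0)}\otimes\psi_k\qquad(a,b,c\in\mathbb F_p,\ i,k\in\mathbb F_p^\times)$$ of degrees $1,p,p,p^2$ are irreducible and pairwise non-isomorphic, and every irreducible representation of $G_p$ is isomorphic to one of them. **The case $p=2$.** Let $G=G_2=\mathrm{Syl}_2(\mathrm{GL}(4,2))$, $\phi_\ell=\phi_{1,\ell}$ for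 $\ell\in\{0,1,\infty\}$, and $\psi=\psi_1$. Then $\mathrm{Hom}(G,\mathbb C^\times)\cong G^{\mathrm{ab}}$; the $\phi_\ell$ are irreducible of degree $2$; $\psi$ is irreducible and faithful of degree $4$. The ring $R(G)$ is generated by $f_{(1,0,0)},f_{(0,1,0)},f_{(0,0,1)},\phi_0,\phi_1,\phi_\infty,\psi$. Under tensoring with the group of the $f_{(a,b,c)}$, the irreducible representations of degree $2$ form exactly three orbits, each of size $2$, represented by $\phi_0,\phi_1,\phi_\infty$, and the irreducible representations of degree $4$ form a single orbit, of size $2$, which is that of $\psi$. In $R(G)$ the following relations hold, for $n,k\in\mathbb F_2$ not both $0$ and $x,y\in\mathbb F_2$ arbitrary: $$f_{(a,b,c)}f_{(a',b',c')}=f_{(a+a',b+b',c+c')},\quad f_{(kx,y,nx)}\phi_{nk^{-1}}=\phi_{nk^{-1}},\quad f_{(x,0,y)}\psi=\psi,$$ $$\phi_{nk^{-1}}^2=\sum_{a,b\in\mathbb F_2}f_{(ka,b,-na)},\qquad \phi_{\ell_1}\phi_{\ell_2}=\phi_{\ell_3}+f_{(a,b,c)}\phi_{\ell_3}$$ whenever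 $\{\ell_1,\ell_2,\ell_3\}=\{0,1,\infty\}$ and $f_{(a,b,c)}\otimes\phi_{\ell_3}\not\cong\phi_{\ell_3}$, $$\psi^2=\sum_{a,b\in\mathbb F_2}f_{(a,0,b)}+\sum_{a,\ell\in\mathbb F_2}f_{(0,0,a)}\phi_\ell+\sum_{a\in\mathbb F_2}f_{(a,0,0)}\phi_\infty,\qquad \phi_\ell\,\psi=\psi+f_{(0,1,0)}\psi\quad(\ell\in\{0,1,\infty\}),$$ and these relations present $R(G)$ as a commutative ring on the seven generators, where $f_{(a,b,c)}$ stands for $f_{(1,0,0)}^af_{(0,1,0)}^bf_{(0,0,1)}^c$ with exponents in $\{0,1\}$. Finally $$\lambda^2(\phi_0)=f_{(1,1,0)},\quad\lambda^2(\phi_1)=f_{(1,1,1)},\quad \lambda^2(\phi_\infty)=f_{(0,1,1)},$$ $$\lambda^2(\psi)=f_{(0,0,1)}\phi_0+f_{(0,0,1)}\phi_1+f_{(1,0,0)}\phi_\infty,\quad \lambda^3(\psi)=f_{(0,1,0)}\psi,\quad\lambda^4(\psi)=f_{(0,1,0)}.$$ -/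

import Mathlib

open scoped TensorProduct

noncomputable section

/-! ### Finite-dimensional complex representations and the representation ring -/

/-- A finite-dimensional complex representation of a group `G`. -/
structure CRep (G : Type) [Group G] where
  V : Type
  [addCommGroup : AddCommGroup V]
  [module : Module ℂ V]
  [finite : Module.Finite ℂ V]
  ρ : Representation ℂ G V

attribute [instance] CRep.addCommGroup CRep.module CRep.finite

namespace CRep

variable {G : Type} [Group G]

/-- `A` and `B` are isomorphic: there is a `G`-equivariant linear equivalence. -/
def Iso (A B : CRep G) : Prop := Nonempty (A.ρ.Equiv B.ρ)

/-- The degree of a representation. -/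
def degree (A : CRep G) : ℕ := Module.finrank ℂ A.V

/-- Irreducibility (the zero representation is not irreducible). -/
def Irred (A : CRep G) : Prop := A.ρ.IsIrreducible

/-- A representation is faithful if `G → GL(V)` is injective. -/
def Faithful (A : CRep G) : Prop := Function.Injective A.ρ

/-- The trivial representation of degree 1. -/
def triv (G : Type) [Group G] : CRep G := ⟨ℂ, Representation.trivial ℂ G ℂ⟩

/-- The direct sum. -/
def sum (A B : CRep G) : CRep G := ⟨A.V × B.V, A.ρ.prod B.ρ⟩

/-- The tensor product. -/
def tensor (A B : CRep G) : CRep G := ⟨A.V ⊗[ℂ] B.V, A.ρ.tprod B.ρ⟩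

/-- The `n`-th exterior power, on which `g` acts by `⋀ⁿ (ρ g)`. -/
def extPow (n : ℕ) (A : CRep G) : CRep G where
  V := ⋀[ℂ]^n A.V
  ρ :=
    { toFun := fun g => exteriorPower.map n (A.ρ g)
      map_one' := by
        rw [map_one]
        exact exteriorPower.map_id
      map_mul' := fun g h => by
        rw [map_mul]
        exact exteriorPower.map_comp (A.ρ h) (A.ρ g) }

/-- The representation of degree 1 on `ℂ` given by a homomorphism `G → ℂˣ`. -/
def ofChar (χ : G →* ℂˣ) : CRep G where
  V := ℂ
  ρ :=
    { toFun := fun g => ((χ g : ℂˣ) : ℂ) • (LinearMap.id : ℂ →ₗ[ℂ] ℂ)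
      map_one' := by ext; simp
      map_mul' := fun g h => by ext; simp [mul_comm] }

/-- Pullback of a representation along a group homomorphism
(restriction to a subgroup, inflation from a quotient). -/
def pullback {K : Type} [Group K] (A : CRep G) (θ : K →* G) : CRep K :=
  ⟨A.V, A.ρ.comp θ⟩

/-- The relations of the representation ring: isomorphic representations are identified, direct
sums become sums, tensor products become products, and the trivial representation becomes `1`. -/
inductive RingRel : MvPolynomial (CRep G) ℤ → Prop
  | iso (A B : CRep G) : A.Iso B → RingRel (MvPolynomial.X A - MvPolynomial.X B)
  | sum (A B : CRep G) :
      RingRel (MvPolynomial.X (A.sum B) - (MvPolynomial.X A + MvPolynomial.X B))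
  | tensor (A B : CRep G) :
      RingRel (MvPolynomial.X (A.tensor B) - MvPolynomial.X A * MvPolynomial.X B)
  | triv : RingRel (MvPolynomial.X (CRep.triv G) - 1)

end CRep

/-- The complex representation ring `R(G)`, i.e. the Grothendieck ring of the semiring of
isomorphism classes of finite-dimensional complex representations under `⊕` and `⊗`: the
commutative ring generated by the symbols `[A]` subject to the relations `CRep.RingRel`. -/
abbrev RepRing (G : Type) [Group G] : Type 1 :=
  MvPolynomial (CRep G) ℤ ⧸ Ideal.span {q : MvPolynomial (CRep G) ℤ | CRep.RingRel q}

/-- The class of a representation in the representation ring. -/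
def CRep.cls {G : Type} [Group G] (A : CRep G) : RepRing G :=
  Ideal.Quotient.mk _ (MvPolynomial.X A)

/-! ### Upper unitriangular matrices -/

theorem unitri_mul {n p : ℕ} [Fact p.Prime] {g h : GL (Fin n) (ZMod p)}
    (hg : (∀ i j, j < i → g.val i j = 0) ∧ ∀ i, g.val i i = 1)
    (hh : (∀ i j, j < i → h.val i j = 0) ∧ ∀ i, h.val i i = 1) :
    (∀ i j, j < i → (g * h).val i j = 0) ∧ ∀ i, (g * h).val i i = 1 := by
  refine ⟨fun i j hij => ?_, fun i => ?_⟩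
  · rw [Units.val_mul, Matrix.mul_apply]
    refine Finset.sum_eq_zero fun k _ => ?_
    rcases lt_or_ge k i with hk | hk
    · rw [hg.1 i k hk, zero_mul]
    · rw [hh.1 k j (lt_of_lt_of_le hij hk), mul_zero]
  · rw [Units.val_mul, Matrix.mul_apply, Finset.sum_eq_single i]
    · rw [hg.2, hh.2, one_mul]
    · intro k _ hk
      rcases lt_or_gt_of_ne hk with hk | hk
      · rw [hg.1 i k hk, zero_mul]
      · rw [hh.1 k i hk, mul_zero]
    · simp

/-- The group of upper triangular `n × n` matrices over `𝔽_p` with all diagonal entries `1`. -/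
def unitri (n p : ℕ) [Fact p.Prime] : Subgroup (GL (Fin n) (ZMod p)) where
  carrier := {g | (∀ i j, j < i → g.val i j = 0) ∧ ∀ i, g.val i i = 1}
  one_mem' := by
    refine ⟨fun i j h => ?_, fun i => ?_⟩
    · simp [h.ne']
    · simp
  mul_mem' := unitri_mul
  inv_mem' := by
    intro g hg
    have hpow : ∀ m : ℕ, (∀ i j, j < i → (g ^ m).val i j = 0) ∧ ∀ i, (g ^ m).val i i = 1 := by
      intro m
      induction m with
      | zero =>
        refine ⟨fun i j h => ?_, fun i => ?_⟩
        · simp [h.ne']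
        · simp
      | succ m ih =>
        rw [pow_succ]
        exact unitri_mul ih hg
    have hinv : g⁻¹ = g ^ (orderOf g - 1) := by
      rw [inv_eq_iff_mul_eq_one, ← pow_succ', Nat.sub_add_cancel (orderOf_pos g)]
      exact pow_orderOf_eq_one g
    rw [hinv]
    exact hpow _

/-- The `(i, j)`-entry of a unitriangular matrix. -/
def ent {n p : ℕ} [Fact p.Prime] (g : unitri n p) (i j : Fin n) : ZMod p := g.val.val i j

theorem ent_lower {n p : ℕ} [Fact p.Prime] (g : unitri n p) {i j : Fin n} (h : j < i) :
    ent g i j = 0 := g.property.1 i j h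

theorem ent_diag {n p : ℕ} [Fact p.Prime] (g : unitri n p) (i : Fin n) : ent g i i = 1 :=
  g.property.2 i

theorem ent_one {n p : ℕ} [Fact p.Prime] {i j : Fin n} (h : i ≠ j) :
    ent (1 : unitri n p) i j = 0 := by
  simp [ent, h]

theorem ent_mul {n p : ℕ} [Fact p.Prime] (g h : unitri n p) (i j : Fin n) :
    ent (g * h) i j = ∑ k, ent g i k * ent h k j := by
  simp [ent, Matrix.mul_apply]

theorem ent_ext {n p : ℕ} [Fact p.Prime] {g h : unitri n p}
    (H : ∀ i j, i < j → ent g i j = ent h i j) : g = h := by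
  apply Subtype.ext
  apply Units.ext
  ext i j
  rcases lt_trichotomy i j with hij | rfl | hij
  · exact H i j hij
  · exact (ent_diag g i).trans (ent_diag h i).symm
  · exact (ent_lower g hij).trans (ent_lower h hij).symm

/-- Entries above the diagonal of a product in the `3 × 3` case. -/
theorem ent_mul3 {p : ℕ} [Fact p.Prime] (g h : unitri 3 p) :
    ent (g * h) 0 1 = ent g 0 1 + ent h 0 1 ∧
    ent (g * h) 1 2 = ent g 1 2 + ent h 1 2 ∧
    ent (g * h) 0 2 = ent h 0 2 + ent g 0 1 * ent h 1 2 + ent g 0 2 := by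
  have a := fun (g : unitri 3 p) => ent_diag g
  have l1 := fun (g : unitri 3 p) => ent_lower g (i := 1) (j := 0) (by decide)
  have l3 := fun (g : unitri 3 p) => ent_lower g (i := 2) (j := 1) (by decide)
  refine ⟨?_, ?_, ?_⟩ <;> rw [ent_mul, Fin.sum_univ_three] <;> simp only [a, l1, l3] <;> ring

/-- Entries above the diagonal of a product in the `4 × 4` case. -/
theorem ent_mul4 {p : ℕ} [Fact p.Prime] (g h : unitri 4 p) :
    ent (g * h) 0 1 = ent g 0 1 + ent h 0 1 ∧
    ent (g * h) 1 2 = ent g 1 2 + ent h 1 2 ∧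
    ent (g * h) 2 3 = ent g 2 3 + ent h 2 3 ∧
    ent (g * h) 0 2 = ent h 0 2 + ent g 0 1 * ent h 1 2 + ent g 0 2 ∧
    ent (g * h) 1 3 = ent h 1 3 + ent g 1 2 * ent h 2 3 + ent g 1 3 ∧
    ent (g * h) 0 3 =
      ent h 0 3 + ent g 0 1 * ent h 1 3 + ent g 0 2 * ent h 2 3 + ent g 0 3 := by
  have a := fun (g : unitri 4 p) => ent_diag g
  have l1 := fun (g : unitri 4 p) => ent_lower g (i := 1) (j := 0) (by decide)
  have l2 := fun (g : unitri 4 p) => ent_lower g (i := 2) (j := 0) (by decide)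
  have l3 := fun (g : unitri 4 p) => ent_lower g (i := 2) (j := 1) (by decide)
  have l5 := fun (g : unitri 4 p) => ent_lower g (i := 3) (j := 1) (by decide)
  have l6 := fun (g : unitri 4 p) => ent_lower g (i := 3) (j := 2) (by decide)
  refine ⟨?_, ?_, ?_, ?_, ?_, ?_⟩ <;> rw [ent_mul, Fin.sum_univ_four] <;>
    simp only [a, l1, l2, l3, l5, l6] <;> ring

/-- The matrix with rows `(1, x, z)`, `(0, 1, y)`, `(0, 0, 1)`. -/
def mk3 {p : ℕ} [Fact p.Prime] (x y z : ZMod p) : unitri 3 p :=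
  ⟨Matrix.GeneralLinearGroup.mkOfDetNeZero !![1, x, z; 0, 1, y; 0, 0, 1]
    (by simp [Matrix.det_fin_three]), by
    constructor
    · intro i j h
      fin_cases i <;> fin_cases j <;>
        first | exact absurd h (by decide) | simp [Matrix.GeneralLinearGroup.mkOfDetNeZero]
    · intro i
      fin_cases i <;> simp [Matrix.GeneralLinearGroup.mkOfDetNeZero]⟩

/-- The matrix with rows `(1, u, x, z)`, `(0, 1, v, y)`, `(0, 0, 1, w)`, `(0, 0, 0, 1)`. -/
def mk4 {p : ℕ} [Fact p.Prime] (u x z v y w : ZMod p) : unitri 4 p :=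
  ⟨Matrix.GeneralLinearGroup.mkOfDetNeZero !![1, u, x, z; 0, 1, v, y; 0, 0, 1, w; 0, 0, 0, 1]
    (by simp [Matrix.det_succ_row_zero, Fin.sum_univ_succ]), by
    constructor
    · intro i j h
      fin_cases i <;> fin_cases j <;>
        first | exact absurd h (by decide) | simp [Matrix.GeneralLinearGroup.mkOfDetNeZero]
    · intro i
      fin_cases i <;> simp [Matrix.GeneralLinearGroup.mkOfDetNeZero]⟩

theorem mk3_mul {p : ℕ} [Fact p.Prime] (x y z x' y' z' : ZMod p) :
    mk3 x y z * mk3 x' y' z' = mk3 (x + x') (y + y') (z' + x * y' + z) := by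
  obtain ⟨h1, h2, h3⟩ := ent_mul3 (mk3 x y z) (mk3 x' y' z')
  refine ent_ext fun i j hij => ?_
  fin_cases i <;> fin_cases j <;>
    first | exact absurd hij (by decide) | exact h1 | exact h2 | exact h3

theorem mk4_mul {p : ℕ} [Fact p.Prime] (u x z v y w u' x' z' v' y' w' : ZMod p) :
    mk4 u x z v y w * mk4 u' x' z' v' y' w' =
      mk4 (u + u') (x' + u * v' + x) (z' + u * y' + x * w' + z) (v + v') (y' + v * w' + y)
        (w + w') := by
  obtain ⟨h1, h2, h3, h4, h5, h6⟩ := ent_mul4 (mk4 u x z v y w) (mk4 u' x' z' v' y' w')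
  refine ent_ext fun i j hij => ?_
  fin_cases i <;> fin_cases j <;>
    first
    | exact absurd hij (by decide) | exact h1 | exact h2 | exact h3 | exact h4 | exact h5
    | exact h6

/-! ### The explicit representations -/

section Explicit

variable {p : ℕ} [Fact p.Prime]

/-- `ζ_p ^ x` for `x ∈ 𝔽_p`, where `ζ_p = exp (2 π i / p)`. -/
def zeta (x : ZMod p) : ℂ := ZMod.stdAddChar x

theorem zeta_add (x y : ZMod p) : zeta (x + y) = zeta x * zeta y :=
  AddChar.map_add_eq_mul _ x y

theorem zeta_zero : zeta (0 : ZMod p) = 1 := AddChar.map_zero_eq_one _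

/-- The homomorphism `f_{(a,b,c)} : G → ℂˣ`, `g ↦ ζ_p ^ (a g₁₂ + b g₂₃ + c g₃₄)`. -/
def linChar (a b c : ZMod p) : unitri 4 p →* ℂˣ :=
  MonoidHom.toHomUnits
    { toFun := fun g => zeta (a * ent g 0 1 + b * ent g 1 2 + c * ent g 2 3)
      map_one' := by
        rw [ent_one (by decide), ent_one (by decide), ent_one (by decide)]
        simp [zeta_zero]
      map_mul' := fun g h => by
        obtain ⟨h1, h2, h3, -⟩ := ent_mul4 g h
        rw [h1, h2, h3, ← zeta_add]
        congr 1
        ring }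

/-- `f_{(a,b,c)}` as a representation of degree 1. -/
def fRep (a b c : ZMod p) : CRep (unitri 4 p) := CRep.ofChar (linChar a b c)

/-- The degree `p` representation `φ_k` of the group of unitriangular `3 × 3` matrices. On the
standard basis `e_j`, `j ∈ 𝔽_p`, of `ℂ^p`, the elementary matrix `E₁₂` acts by the cyclic shift
`e_j ↦ e_{j+1}` and `E₂₃` acts by `e_j ↦ ζ_p ^ (j k) e_j`; see `heisRep_E12`, `heisRep_E23`. -/
def heisRep (k : ZMod p) : CRep (unitri 3 p) where
  V := ZMod p → ℂ
  ρ :=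
    { toFun := fun g =>
        { toFun := fun f j => zeta (k * (j * ent g 1 2 - ent g 0 2)) * f (j - ent g 0 1)
          map_add' := fun f f' => by ext j; simp [mul_add]
          map_smul' := fun c f => by ext j; simp; ring }
      map_one' := by
        ext f j
        simp [ent_one, zeta_zero]
      map_mul' := fun g h => by
        obtain ⟨h1, h2, h3⟩ := ent_mul3 g h
        refine LinearMap.ext fun f => funext fun j => ?_
        change zeta _ * f _ = zeta _ * (zeta _ * f _)
        rw [← mul_assoc, ← zeta_add, h1, h2, h3]
        congr 2
        · ring
        · ring }

theorem heisRep_E12 (k j : ZMod p) :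
    (heisRep k).ρ (mk3 1 0 0) (Pi.single j (1 : ℂ) : ZMod p → ℂ) =
      (Pi.single (j + 1) (1 : ℂ) : ZMod p → ℂ) := by
  refine funext fun x => ?_
  change zeta (k * (x * 0 - 0)) * (Pi.single j (1 : ℂ) : ZMod p → ℂ) (x - 1) = _
  simp [zeta_zero, Pi.single_apply, sub_eq_iff_eq_add]

theorem heisRep_E23 (k j : ZMod p) :
    (heisRep k).ρ (mk3 0 1 0) (Pi.single j (1 : ℂ) : ZMod p → ℂ) =
      zeta (j * k) • (Pi.single j (1 : ℂ) : ZMod p → ℂ) := by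
  refine funext fun x => ?_
  change zeta (k * (x * 1 - 0)) * (Pi.single j (1 : ℂ) : ZMod p → ℂ) (x - 0) =
    zeta (j * k) * (Pi.single j (1 : ℂ) : ZMod p → ℂ) x
  rcases eq_or_ne x j with rfl | h
  · simp [mul_comm]
  · simp [h]

/-- For `ℓ ∈ 𝔽_p`, the retraction of `G` onto the upper left `3 × 3` block `H_∞` with kernel
`N_ℓ`. -/
def retrInf (l : ZMod p) : unitri 4 p →* unitri 3 p :=
  MonoidHom.mk' (fun g => mk3 (ent g 0 1 - l * ent g 2 3) (ent g 1 2)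
    (ent g 0 2 + l * (ent g 1 3 - ent g 1 2 * ent g 2 3))) fun g h => by
    obtain ⟨h1, h2, h3, h4, h5, -⟩ := ent_mul4 g h
    rw [mk3_mul, h1, h2, h3, h4, h5]
    congr 1 <;> ring

/-- For `m ∈ 𝔽_p`, the retraction of `G` onto the lower right `3 × 3` block `H_0` with kernel
`N_{1/m}` (which is `N_∞` for `m = 0`). -/
def retrZero (m : ZMod p) : unitri 4 p →* unitri 3 p :=
  MonoidHom.mk' (fun g => mk3 (ent g 1 2) (ent g 2 3 - m * ent g 0 1)
    (ent g 1 3 + m * (ent g 0 2 - ent g 0 1 * ent g 1 2))) fun g h => by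
    obtain ⟨h1, h2, h3, h4, h5, -⟩ := ent_mul4 g h
    rw [mk3_mul, h1, h2, h3, h4, h5]
    congr 1 <;> ring

/-- The inclusion of the `3 × 3` group as the upper left block `H_∞` of `G`. -/
def inclInf : unitri 3 p →* unitri 4 p :=
  MonoidHom.mk' (fun g => mk4 (ent g 0 1) (ent g 0 2) 0 (ent g 1 2) 0 0) fun g h => by
    obtain ⟨h1, h2, h3⟩ := ent_mul3 g h
    rw [mk4_mul, h1, h2, h3]
    congr 1 <;> ring

/-- The inclusion of the `3 × 3` group as the lower right block `H_0` of `G`. -/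
def inclZero : unitri 3 p →* unitri 4 p :=
  MonoidHom.mk' (fun g => mk4 0 0 0 (ent g 0 1) (ent g 0 2) (ent g 1 2)) fun g h => by
    obtain ⟨h1, h2, h3⟩ := ent_mul3 g h
    rw [mk4_mul, h1, h2, h3]
    congr 1 <;> ring

/-- `φ_{i,ℓ,∞}` for `ℓ ∈ 𝔽_p`: the inflation of `φ_i` along `G → G / N_ℓ ≅ H_∞`. -/
def phiInf (i l : ZMod p) : CRep (unitri 4 p) := (heisRep i).pullback (retrInf l)

/-- `φ_{i,1/m,0}` for `m ∈ 𝔽_p`: the inflation of `φ_i` along `G → G / N_{1/m} ≅ H_0`. -/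
def phiZero (i m : ZMod p) : CRep (unitri 4 p) := (heisRep i).pullback (retrZero m)

/-- The family `φ_{i,ℓ}`, `ℓ ∈ 𝔽_p ∪ {∞}`: it is `φ_{i,ℓ,∞}` for `ℓ ≠ ∞` and `φ_{i,∞,0}` for
`ℓ = ∞`. -/
def phi (i : ZMod p) (l : OnePoint (ZMod p)) : CRep (unitri 4 p) :=
  OnePoint.rec (phiZero i 0) (fun l => phiInf i l) l

/-- The fraction `n k⁻¹ ∈ 𝔽_p ∪ {∞}` (used only for `(n, k) ≠ (0, 0)`). -/
def frac (n k : ZMod p) : OnePoint (ZMod p) := if k = 0 then OnePoint.infty else ↑(n / k)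

/-- The degree `p ^ 2` representation `ψ_k` of `G`. On the standard basis `e_{i,j}`,
`(i, j) ∈ 𝔽_p × 𝔽_p`, of `ℂ^(p ^ 2)`, the elementary matrices act by `E₁₂ : e_{i,j} ↦ e_{i,j+1}`,
`E₂₃ : e_{i,j} ↦ ζ_p ^ (i j k) e_{i,j}`, `E₃₄ : e_{i,j} ↦ e_{i+1,j}`; see `psiRep_E12`,
`psiRep_E23`, `psiRep_E34`. -/
def psiRep (k : ZMod p) : CRep (unitri 4 p) where
  V := ZMod p × ZMod p → ℂ
  ρ :=
    { toFun := fun g =>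
        { toFun := fun f t =>
            zeta (k * ((t.1 - ent g 2 3) * t.2 * ent g 1 2 + t.2 * ent g 1 3
              - (t.1 - ent g 2 3) * ent g 0 2 - ent g 0 3)) *
            f (t.1 - ent g 2 3, t.2 - ent g 0 1)
          map_add' := fun f f' => by ext t; simp [mul_add]
          map_smul' := fun c f => by ext t; simp; ring }
      map_one' := by
        ext f t
        simp [ent_one, zeta_zero]
      map_mul' := fun g h => by
        obtain ⟨h1, h2, h3, h4, h5, h6⟩ := ent_mul4 g h
        refine LinearMap.ext fun f => funext fun t => ?_
        change zeta _ * f _ = zeta _ * (zeta _ * f _)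
        rw [← mul_assoc, ← zeta_add, h1, h2, h3, h4, h5, h6]
        congr 2
        · ring
        · ext <;> dsimp only <;> ring }

theorem psiRep_E12 (k i j : ZMod p) :
    (psiRep k).ρ (mk4 1 0 0 0 0 0) (Pi.single (i, j) (1 : ℂ) : ZMod p × ZMod p → ℂ) =
      (Pi.single (i, j + 1) (1 : ℂ) : ZMod p × ZMod p → ℂ) := by
  refine funext fun ⟨x, y⟩ => ?_
  change zeta (k * ((x - 0) * y * 0 + y * 0 - (x - 0) * 0 - 0)) *
    (Pi.single (i, j) (1 : ℂ) : ZMod p × ZMod p → ℂ) (x - 0, y - 1) = _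
  simp [zeta_zero, Pi.single_apply, sub_eq_iff_eq_add]

theorem psiRep_E23 (k i j : ZMod p) :
    (psiRep k).ρ (mk4 0 0 0 1 0 0) (Pi.single (i, j) (1 : ℂ) : ZMod p × ZMod p → ℂ) =
      zeta (i * j * k) • (Pi.single (i, j) (1 : ℂ) : ZMod p × ZMod p → ℂ) := by
  refine funext fun ⟨x, y⟩ => ?_
  change zeta (k * ((x - 0) * y * 1 + y * 0 - (x - 0) * 0 - 0)) *
    (Pi.single (i, j) (1 : ℂ) : ZMod p × ZMod p → ℂ) (x - 0, y - 0) =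
    zeta (i * j * k) * (Pi.single (i, j) (1 : ℂ) : ZMod p × ZMod p → ℂ) (x, y)
  rcases eq_or_ne (x, y) (i, j) with h | h
  · obtain ⟨rfl, rfl⟩ := Prod.mk.inj h
    simp [mul_comm]
  · simp [h]

theorem psiRep_E34 (k i j : ZMod p) :
    (psiRep k).ρ (mk4 0 0 0 0 0 1) (Pi.single (i, j) (1 : ℂ) : ZMod p × ZMod p → ℂ) =
      (Pi.single (i + 1, j) (1 : ℂ) : ZMod p × ZMod p → ℂ) := by
  refine funext fun ⟨x, y⟩ => ?_
  change zeta (k * ((x - 1) * y * 0 + y * 0 - (x - 1) * 0 - 0)) *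
    (Pi.single (i, j) (1 : ℂ) : ZMod p × ZMod p → ℂ) (x - 1, y - 0) = _
  simp [zeta_zero, Pi.single_apply, sub_eq_iff_eq_add]

/-- The orbit of `A` under tensoring with the representations `f_{(a,b,c)}`, as a set of classes
in the representation ring. -/
def charOrbit (A : CRep (unitri 4 p)) : Set (RepRing (unitri 4 p)) :=
  {x | ∃ a b c : ZMod p, x = ((fRep a b c).tensor A).cls}

/-- Index set for the list of irreducible representations of `G`. -/
inductive IrrIndex (p : ℕ) [Fact p.Prime] : Type
  | lin (a b c : ZMod p)
  | mid (a : ZMod p) (i : (ZMod p)ˣ) (l : ZMod p)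
  | midInf (a : ZMod p) (i : (ZMod p)ˣ)
  | top (a : ZMod p) (k : (ZMod p)ˣ)

/-- The list of irreducible representations of `G`: `f_{(a,b,c)}`, `f_{(0,0,a)} ⊗ φ_{i,ℓ}` for
`ℓ ∈ 𝔽_p`, `f_{(a,0,0)} ⊗ φ_{i,∞}`, and `f_{(0,a,0)} ⊗ ψ_k`. -/
def irrRep : IrrIndex p → CRep (unitri 4 p)
  | .lin a b c => fRep a b c
  | .mid a i l => (fRep 0 0 a).tensor (phi i l)
  | .midInf a i => (fRep a 0 0).tensor (phi i OnePoint.infty)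
  | .top a k => (fRep 0 a 0).tensor (psiRep k)

end Explicit

/-! ### The case `p = 2` -/

/-- `φ_ℓ` for `ℓ ∈ {0, 1, ∞}`, in the case `p = 2`. -/
def phi2 (l : OnePoint (ZMod 2)) : CRep (unitri 4 2) := phi 1 l

/-- `ψ`, in the case `p = 2`. -/
def psi2 : CRep (unitri 4 2) := psiRep 1

/-- Names for the seven generators `f_{(1,0,0)}`, `f_{(0,1,0)}`, `f_{(0,0,1)}`, `φ_ℓ`, `ψ`. -/
inductive Gen2 : Type
  | e1
  | e2
  | e3
  | phi (l : OnePoint (ZMod 2))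
  | psi

/-- The element of `R(G)` named by a generator. -/
def Gen2.val : Gen2 → RepRing (unitri 4 2)
  | .e1 => (fRep 1 0 0).cls
  | .e2 => (fRep 0 1 0).cls
  | .e3 => (fRep 0 0 1).cls
  | .phi l => (phi2 l).cls
  | .psi => psi2.cls

/-- The monomial in the generators that represents `f_{(a,b,c)}`. -/
def polyF (a b c : ZMod 2) : MvPolynomial Gen2 ℤ :=
  MvPolynomial.X .e1 ^ a.val * MvPolynomial.X .e2 ^ b.val * MvPolynomial.X .e3 ^ c.val

def polyPhi (l : OnePoint (ZMod 2)) : MvPolynomial Gen2 ℤ := MvPolynomial.X (.phi l)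

def polyPsi : MvPolynomial Gen2 ℤ := MvPolynomial.X .psi

/-- The multiplicative relations between the seven generators of `R(G)`, for `p = 2`. -/
inductive MulRel2 : MvPolynomial Gen2 ℤ → Prop
  | f_mul (a b c a' b' c' : ZMod 2) :
      MulRel2 (polyF a b c * polyF a' b' c' - polyF (a + a') (b + b') (c + c'))
  | f_phi (n k x y : ZMod 2) : (n, k) ≠ (0, 0) →
      MulRel2 (polyF (k * x) y (n * x) * polyPhi (frac n k) - polyPhi (frac n k))
  | f_psi (x y : ZMod 2) : MulRel2 (polyF x 0 y * polyPsi - polyPsi)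
  | phi_sq (n k : ZMod 2) : (n, k) ≠ (0, 0) →
      MulRel2 (polyPhi (frac n k) ^ 2 - ∑ a : ZMod 2, ∑ b : ZMod 2, polyF (k * a) b (-(n * a)))
  | phi_mul (l₁ l₂ l₃ : OnePoint (ZMod 2)) (a b c : ZMod 2) : l₁ ≠ l₂ → l₁ ≠ l₃ → l₂ ≠ l₃ →
      ¬ ((fRep a b c).tensor (phi2 l₃)).Iso (phi2 l₃) →
      MulRel2 (polyPhi l₁ * polyPhi l₂ - (polyPhi l₃ + polyF a b c * polyPhi l₃))
  | psi_sq :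
      MulRel2 (polyPsi ^ 2 -
        ((∑ a : ZMod 2, ∑ b : ZMod 2, polyF a 0 b) +
          (∑ a : ZMod 2, ∑ l : ZMod 2, polyF 0 0 a * polyPhi l) +
          ∑ a : ZMod 2, polyF a 0 0 * polyPhi OnePoint.infty))
  | phi_psi (l : OnePoint (ZMod 2)) :
      MulRel2 (polyPhi l * polyPsi - (polyPsi + polyF 0 1 0 * polyPsi))

end

/-! ### Characters, direct sums and classes in the representation ring. -/

namespace CRep

variable {G : Type} [Group G]

/-! The irreducible representations are obtained from one character computation. If a family `R t`
with positive degrees d_t and characters χ_t satisfies Σ d_t χ_t(g) = 0 for g ≠ 1 and Σ d_t² = |G|,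
then Σ d_t χ_t is the regular character, and pairing it with the character of any A gives Σ d_t dim
Hom(R t, A) = deg A. For A = R s the term t = s already accounts for d_s, so dim Hom(R t, R s) =
δ_ts; and every nonzero A receives a nonzero map from some R t. Hence the members are irreducible,
pairwise non-isomorphic and a complete list (`IsRegularFamily`). For the list in question this is
`irrRep_isRegularFamily`: the characters are traces of explicit monomial matrices, evaluated by
orthogonality of the additive characters of 𝔽_p. A twist by f_{(a,b,c)} changes a character only on
its support, and this gives stabilizers and orbits.

The number of conjugacy classes is found independently, by counting commuting pairs
(`card_commute`).

Although R(G) is given by generators and relations, Maschke's theorem and orthogonality show that it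
is ℤ-free on the irreducible classes, and that its elements are determined by their characters
(`IsRegularFamily.ext`). For p = 2 we have ζ = -1, all relevant characters are integer-valued on a
group of 64 elements, and the product formulas become finite checks. Exterior powers reduce to
characters of powers of g through eigenvalues and Newton's identities.

For the presentation, the relations suffice to rewrite every polynomial in the seven generators as
an integral combination of 16 monomials, one for each irreducible representation (`mk_mem_irrSpan`).
These map to linearly independent elements of R(G), so there are no further relations
(`ker_aeval_gen2`). -/

theorem Iso.refl (A : CRep G) : A.Iso A := ⟨Representation.Equiv.refl A.ρ⟩

theorem Iso.symm {A B : CRep G} (h : A.Iso B) : B.Iso A := h.map Representation.Equiv.symm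

theorem Iso.trans {A B C : CRep G} (h : A.Iso B) (h' : B.Iso C) : A.Iso C :=
  ⟨h.some.trans h'.some⟩

/-- The character of a representation. -/
noncomputable def char (A : CRep G) (g : G) : ℂ := A.ρ.character g

theorem Iso.char_eq {A B : CRep G} (h : A.Iso B) (g : G) : A.char g = B.char g :=
  congrFun (Representation.char_iso h.some) g

theorem char_one (A : CRep G) : A.char 1 = A.degree := Representation.char_one A.ρ

theorem Iso.degree_eq {A B : CRep G} (h : A.Iso B) : A.degree = B.degree := by
  have := h.char_eq 1
  rw [char_one, char_one] at this
  exact_mod_cast this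

theorem char_tensor (A B : CRep G) (g : G) : (A.tensor B).char g = A.char g * B.char g :=
  congrFun (Representation.char_tensor A.ρ B.ρ) g

theorem char_sum (A B : CRep G) (g : G) : (A.sum B).char g = A.char g + B.char g :=
  LinearMap.trace_prodMap' (A.ρ g) (B.ρ g)

theorem char_triv (g : G) : (triv G).char g = 1 := by
  have h : (triv G).ρ g = (1 : ℂ →ₗ[ℂ] ℂ) := rfl
  unfold char Representation.character
  rw [h]
  exact (LinearMap.trace_one ℂ ℂ).trans (by simp)

theorem char_ofChar (χ : G →* ℂˣ) (g : G) : (ofChar χ).char g = (χ g : ℂ) := by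
  change LinearMap.trace ℂ ℂ (((χ g : ℂˣ) : ℂ) • (1 : ℂ →ₗ[ℂ] ℂ)) = _
  rw [map_smul, LinearMap.trace_one]
  simp

theorem cls_iso {A B : CRep G} (h : A.Iso B) : A.cls = B.cls :=
  Ideal.Quotient.eq.2 (Ideal.subset_span (RingRel.iso A B h))

theorem cls_sum (A B : CRep G) : (A.sum B).cls = A.cls + B.cls := by
  rw [cls, cls, cls, ← map_add]
  exact Ideal.Quotient.eq.2 (Ideal.subset_span (RingRel.sum A B))

theorem cls_tensor (A B : CRep G) : (A.tensor B).cls = A.cls * B.cls := by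
  rw [cls, cls, cls, ← map_mul]
  exact Ideal.Quotient.eq.2 (Ideal.subset_span (RingRel.tensor A B))

theorem cls_triv : (triv G).cls = 1 := by
  rw [cls, ← map_one (Ideal.Quotient.mk _)]
  exact Ideal.Quotient.eq.2 (Ideal.subset_span RingRel.triv)

/-- Evaluation of characters at `g`, as a ring homomorphism `R(G) → ℂ`. -/
noncomputable def charHom (g : G) : RepRing G →+* ℂ :=
  Ideal.Quotient.lift _ (MvPolynomial.aeval (R := ℤ) fun A : CRep G => A.char g).toRingHom <| by
    intro a ha
    have : Ideal.span {q : MvPolynomial (CRep G) ℤ | RingRel q} ≤ RingHom.ker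
        (MvPolynomial.aeval (R := ℤ) fun A : CRep G => A.char g).toRingHom := by
      refine Ideal.span_le.2 ?_
      rintro q (⟨A, B, h⟩ | ⟨A, B⟩ | ⟨A, B⟩ | _)
      · simp [RingHom.mem_ker, h.char_eq]
      · simp [RingHom.mem_ker, char_sum]
      · simp [RingHom.mem_ker, char_tensor]
      · simp [RingHom.mem_ker, char_triv]
    exact this ha

theorem charHom_cls (A : CRep G) (g : G) : charHom g A.cls = A.char g := by
  refine (Ideal.Quotient.lift_mk _ _ _).trans ?_
  simp

/-- No defining relation mentions the zero representation, but it is isomorphic to its own double,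
so its class x satisfies x = x + x. -/
theorem cls_eq_zero {A : CRep G} (h : A.degree = 0) : A.cls = 0 := by
  have : Subsingleton A.V := Module.finrank_zero_iff.1 h
  have h1 : A.Iso (A.sum A) :=
    have : Subsingleton (A.sum A).V := inferInstanceAs (Subsingleton (A.V × A.V))
    ⟨Representation.Equiv.mk (0 : A.V ≃ₗ[ℂ] (A.sum A).V) fun g => LinearMap.ext fun x =>
      Subsingleton.elim _ _⟩
  have h2 := (cls_iso h1).trans (cls_sum A A)
  simpa using h2

/-- The representation on an invariant subspace. -/
def sub (A : CRep G) (p : Subrepresentation A.ρ) : CRep G := ⟨p.toSubmodule, p.toRepresentation⟩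

theorem isCompl_toSubmodule {A : CRep G} {p q : Subrepresentation A.ρ} (h : IsCompl p q) :
    IsCompl p.toSubmodule q.toSubmodule := by
  refine ⟨?_, ?_⟩
  · rw [disjoint_iff, ← Subrepresentation.toSubmodule_inf, h.inf_eq_bot]
    rfl
  · rw [codisjoint_iff, ← Subrepresentation.toSubmodule_sup, h.sup_eq_top]
    rfl

noncomputable def sumEquiv {A : CRep G} {p q : Subrepresentation A.ρ} (h : IsCompl p q) :
    ((A.sub p).sum (A.sub q)).ρ.Equiv A.ρ :=
  Representation.Equiv.mk (Submodule.prodEquivOfIsCompl _ _ (isCompl_toSubmodule h)) fun g =>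
    LinearMap.ext fun x => by
      exact (map_add (A.ρ g) (x.1 : p.toSubmodule).1 (x.2 : q.toSubmodule).1).symm

theorem Iso.sum {A A' B B' : CRep G} (h : A.Iso A') (h' : B.Iso B') :
    (A.sum B).Iso (A'.sum B') := by
  obtain ⟨e⟩ := h
  obtain ⟨e'⟩ := h'
  refine ⟨Representation.Equiv.mk (LinearEquiv.prodCongr e.toLinearEquiv e'.toLinearEquiv)
    fun g => LinearMap.ext fun x => ?_⟩
  exact Prod.ext (e.toIntertwiningMap.isIntertwining _ _ g x.1)
    (e'.toIntertwiningMap.isIntertwining _ _ g x.2)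

end CRep

/-! ### Orthogonality, Maschke's theorem and regular families. -/

namespace CRep

variable {G : Type} [Group G]

/-- The dimension of the space of equivariant maps. -/
noncomputable def homDim (A B : CRep G) : ℕ := Module.finrank ℂ (A.ρ.IntertwiningMap B.ρ)

/-- Averaging over G projects linear maps onto equivariant ones, and the trace of this projection is
the dimension. The form multiplied by |G| needs no inverse. -/
theorem sum_char_mul_char [Fintype G] (A B : CRep G) :
    ∑ g : G, B.char g * A.char g⁻¹ = (Nat.card G : ℂ) * homDim A B := by
  have h0 : (Nat.card G : ℂ) ≠ 0 := by exact_mod_cast Nat.card_pos.ne'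
  let := invertibleOfNonzero h0
  have h := Representation.card_inv_mul_sum_char_mul_char_eq_finrank A.ρ B.ρ
  rw [inv_mul_eq_iff_eq_mul₀ h0] at h
  exact h

/-- Maschke's theorem: |G| is nonzero in ℂ. -/
theorem exists_isCompl [Finite G] (A : CRep G) (p : Subrepresentation A.ρ) :
    ∃ q, IsCompl p q := by
  have : NeZero (Nat.card G : ℂ) := ⟨by exact_mod_cast Nat.card_pos.ne'⟩
  have : IsSemisimpleModule (MonoidAlgebra ℂ G) A.ρ.asModule := inferInstance
  have := (Representation.isSemisimpleRepresentation_iff_isSemisimpleModule_asModule A.ρ).2 this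
  exact this.exists_isCompl p

theorem homDim_congr {A A' B B' : CRep G} [Fintype G] (h : A.Iso A') (h' : B.Iso B') :
    homDim A B = homDim A' B' := by
  have h1 := sum_char_mul_char A B
  have h2 := sum_char_mul_char A' B'
  simp only [h.char_eq, h'.char_eq] at h1
  have h0 : (Nat.card G : ℂ) ≠ 0 := by exact_mod_cast Nat.card_pos.ne'
  exact_mod_cast mul_left_cancel₀ h0 (h1.symm.trans h2)

theorem homDim_self_pos {A : CRep G} (h : 0 < A.degree) : 0 < homDim A A := by
  have : Nontrivial A.V := Module.finrank_pos_iff.1 h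
  obtain ⟨x, hx⟩ := exists_ne (0 : A.V)
  have : Nontrivial (A.ρ.IntertwiningMap A.ρ) :=
    ⟨Representation.IntertwiningMap.id A.ρ, 0, fun h => hx (congrArg (fun f => f x) h)⟩
  exact Module.finrank_pos

/-- A representation with only scalar endomorphisms is irreducible. -/
theorem irred_of_homDim_self [Finite G] {A : CRep G} (h : homDim A A = 1) : A.Irred := by
  have hnt : Nontrivial A.V := by
    by_contra hA
    rw [not_nontrivial_iff_subsingleton] at hA
    have : Subsingleton (A.ρ.IntertwiningMap A.ρ) :=
      ⟨fun f g => Representation.IntertwiningMap.ext (LinearMap.ext fun x => Subsingleton.elim _ _)⟩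
    have := Module.finrank_zero_of_subsingleton (R := ℂ) (M := A.ρ.IntertwiningMap A.ρ)
    unfold homDim at h
    omega
  have hid : Representation.IntertwiningMap.id A.ρ ≠ 0 := by
    obtain ⟨x, hx⟩ := exists_ne (0 : A.V)
    exact fun h => hx (congrArg (fun f => f x) h)
  have key := (finrank_eq_one_iff_of_nonzero' _ hid).1 h
  refine
    { exists_pair_ne := ⟨⊥, ⊤, fun hbt => ?_⟩
      eq_bot_or_eq_top := fun p => ?_ }
  · obtain ⟨x, hx⟩ := exists_ne (0 : A.V)
    have : x ∈ (⊥ : Subrepresentation A.ρ).toSubmodule := by rw [hbt]; trivial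
    exact hx this
  · obtain ⟨q, hq⟩ := exists_isCompl A p
    let e := sumEquiv hq
    -- The projection onto `p` along `q`. It is a scalar c by assumption; c = 0 gives p = 0, and c ≠
    -- 0 gives q = 0.
    let f : A.ρ.IntertwiningMap A.ρ :=
      (e.toIntertwiningMap.comp (Representation.IntertwiningMap.inl ℂ (A.sub p).ρ (A.sub q).ρ)).comp
        ((Representation.IntertwiningMap.fst ℂ (A.sub p).ρ (A.sub q).ρ).comp
          e.symm.toIntertwiningMap)
    obtain ⟨c, hc⟩ := key f
    have hf : ∀ (x : p.toSubmodule) (y : q.toSubmodule), c • (x + y : A.V) = x := by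
      intro x y
      have h1 : f (x + y : A.V) = x := by
        have h2 : e.symm (x + y : A.V) = (x, y) := by
          have h3 : (x + y : A.V) = e ((x, y) : p.toSubmodule × q.toSubmodule) := rfl
          rw [h3]
          exact e.toLinearEquiv.symm_apply_apply _
        change e ((e.symm (x + y : A.V)).1, 0) = _
        rw [h2]
        exact add_zero (x : A.V)
      rw [← hc] at h1
      exact h1
    by_cases hc0 : c = 0
    · left
      refine le_bot_iff.1 fun x hx => ?_
      have := hf ⟨x, hx⟩ 0
      rw [hc0, zero_smul] at this
      exact this.symm
    · right
      have hq0 : q = ⊥ := by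
        refine le_bot_iff.1 fun y hy => ?_
        have := hf 0 ⟨y, hy⟩
        simp only [ZeroMemClass.coe_zero, zero_add, smul_eq_zero, hc0, false_or] at this
        exact this
      have := hq.sup_eq_top
      rwa [hq0, sup_bot_eq] at this

/-- Schur's lemma. -/
theorem iso_of_homDim_ne_zero {A B : CRep G} (hA : A.Irred) (hB : B.Irred)
    (h : homDim A B ≠ 0) : A.Iso B := by
  have : A.ρ.IsIrreducible := hA
  have : B.ρ.IsIrreducible := hB
  by_contra hAB
  have : IsEmpty (A.ρ.Equiv B.ρ) := not_nonempty_iff.1 hAB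
  exact h (Module.finrank_zero_of_subsingleton)

/-- An irreducible representation with a nonzero map to `A` is a direct summand of `A`. -/
theorem exists_iso_sum [Finite G] {S A : CRep G} (hS : S.Irred) (h : homDim S A ≠ 0) :
    ∃ B : CRep G, A.Iso (S.sum B) := by
  have : S.ρ.IsIrreducible := hS
  have : Nontrivial (S.ρ.IntertwiningMap A.ρ) :=
    Module.nontrivial_of_finrank_pos (R := ℂ) (Nat.pos_of_ne_zero h)
  obtain ⟨f, hf⟩ := exists_ne (0 : S.ρ.IntertwiningMap A.ρ)
  have hinj : Function.Injective f.toLinearMap :=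
    (Representation.IsIrreducible.injective_or_eq_zero f).resolve_right hf
  obtain ⟨q, hq⟩ := exists_isCompl A f.range
  refine ⟨A.sub q, Iso.symm (Iso.trans (Iso.sum ?_ (Iso.refl _)) ⟨sumEquiv hq⟩)⟩
  exact ⟨Representation.Equiv.mk (LinearEquiv.ofInjective f.toLinearMap hinj) fun g =>
    LinearMap.ext fun x => Subtype.ext (f.isIntertwining _ _ g x)⟩

theorem degree_sum (A B : CRep G) : (A.sum B).degree = A.degree + B.degree :=
  Module.finrank_prod

theorem degree_tensor (A B : CRep G) : (A.tensor B).degree = A.degree * B.degree :=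
  Module.finrank_tensorProduct

theorem degree_ofChar (χ : G →* ℂˣ) : (ofChar χ).degree = 1 := Module.finrank_self ℂ

/-- A family of representations through which the regular character decomposes in the way
in which it decomposes through the irreducible representations. -/
structure IsRegularFamily [Fintype G] {I : Type} [Fintype I] (R : I → CRep G) : Prop where
  degree_pos : ∀ t, 0 < (R t).degree
  sum_eq : ∀ g : G, g ≠ 1 → ∑ t, ((R t).degree : ℂ) * (R t).char g = 0
  sum_sq : ∑ t, (R t).degree ^ 2 = Nat.card G

namespace IsRegularFamily

variable [Fintype G] {I : Type} [Fintype I] {R : I → CRep G}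

/-- Σ d_t χ_t is the regular character, so in its pairing with the character of A only the term g =
1 survives, with value |G| · deg A. -/
theorem sum_degree_mul_homDim (h : IsRegularFamily R)
    (A : CRep G) :
    ∑ t, (R t).degree * homDim (R t) A = A.degree := by
  have h0 : (Nat.card G : ℂ) ≠ 0 := by exact_mod_cast Nat.card_pos.ne'
  have h1 : (Nat.card G : ℂ) * ∑ t, ((R t).degree : ℂ) * homDim (R t) A =
      Nat.card G * A.degree := by
    calc (Nat.card G : ℂ) * ∑ t, ((R t).degree : ℂ) * homDim (R t) A
        = ∑ t, ((R t).degree : ℂ) * ∑ g : G, A.char g * (R t).char g⁻¹ := by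
          simp only [sum_char_mul_char, Finset.mul_sum]
          exact Finset.sum_congr rfl fun _ _ => by ring
      _ = ∑ g : G, A.char g * ∑ t, ((R t).degree : ℂ) * (R t).char g⁻¹ := by
          simp only [Finset.mul_sum]
          rw [Finset.sum_comm]
          exact Finset.sum_congr rfl fun _ _ => Finset.sum_congr rfl fun _ _ => by ring
      _ = A.char 1 * ∑ t, ((R t).degree : ℂ) * (R t).char 1⁻¹ := by
          refine Finset.sum_eq_single _ (fun g _ hg => ?_) (by simp)
          rw [h.sum_eq _ (inv_ne_one.2 hg), mul_zero]
      _ = _ := by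
          rw [char_one, mul_comm, ← h.sum_sq]
          simp [char_one, sq]
  have := mul_left_cancel₀ h0 h1
  exact_mod_cast this

-- Apply `sum_degree_mul_homDim` to A = R t. The identity makes the term at t at least deg (R t),
-- which is the whole sum; so the other terms vanish and the endomorphisms are scalars.
open scoped Classical in
theorem homDim_eq (h : IsRegularFamily R)
    (s t : I) : homDim (R s) (R t) = if s = t then 1 else 0 := by
  have h1 := h.sum_degree_mul_homDim (R t)
  rw [← Finset.add_sum_erase _ _ (Finset.mem_univ t)] at h1
  have hp := homDim_self_pos (h.degree_pos t)
  have hd := h.degree_pos t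
  have h2 : (R t).degree ≤ (R t).degree * homDim (R t) (R t) := Nat.le_mul_of_pos_right _ hp
  have h3 : ∑ x ∈ Finset.univ.erase t, (R x).degree * homDim (R x) (R t) = 0 := by omega
  split_ifs with hst
  · subst hst
    rw [h3, add_zero] at h1
    exact Nat.eq_of_mul_eq_mul_left hd (h1.trans (mul_one _).symm)
  · have := Finset.sum_eq_zero_iff.1 h3 s (Finset.mem_erase.2 ⟨hst, Finset.mem_univ _⟩)
    exact (Nat.mul_eq_zero.1 this).resolve_left (h.degree_pos s).ne'

theorem irred (h : IsRegularFamily R)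
    (t : I) : (R t).Irred := irred_of_homDim_self (by simp [h.homDim_eq])

theorem eq_of_iso (h : IsRegularFamily R)
    {s t : I} (hst : (R s).Iso (R t)) : s = t := by
  classical
  by_contra hne
  have h1 := h.homDim_eq s t
  rw [if_neg hne, ← homDim_congr (Iso.refl _) hst, h.homDim_eq, if_pos rfl] at h1
  exact one_ne_zero h1

theorem exists_homDim_ne_zero (h : IsRegularFamily R)
    {A : CRep G} (hA : A.degree ≠ 0) : ∃ t, homDim (R t) A ≠ 0 := by
  by_contra! hn
  exact hA (by rw [← h.sum_degree_mul_homDim A]; simp [hn])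

theorem exists_iso (h : IsRegularFamily R)
    {A : CRep G} (hA : A.Irred) : ∃ t, A.Iso (R t) := by
  have hd : A.degree ≠ 0 := fun hd => by
    have : Subsingleton A.V := Module.finrank_zero_iff.1 hd
    obtain ⟨p, q, hpq⟩ := hA.exists_pair_ne
    refine hpq (SetLike.ext fun x => ?_)
    have hx : x = 0 := Subsingleton.elim _ _
    exact ⟨fun _ => hx ▸ q.toSubmodule.zero_mem, fun _ => hx ▸ p.toSubmodule.zero_mem⟩
  obtain ⟨t, ht⟩ := h.exists_homDim_ne_zero hd
  exact ⟨t, (iso_of_homDim_ne_zero (h.irred t) hA ht).symm⟩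

/-- Irreducible summands are split off one at a time, by induction on the degree. -/
theorem cls_mem_span (h : IsRegularFamily R)
    (A : CRep G) : A.cls ∈ Submodule.span ℤ (Set.range fun t => (R t).cls) := by
  induction hn : A.degree using Nat.strong_induction_on generalizing A with
  | _ n ih =>
    by_cases h0 : A.degree = 0
    · rw [cls_eq_zero h0]
      exact Submodule.zero_mem _
    · obtain ⟨t, ht⟩ := h.exists_homDim_ne_zero h0
      obtain ⟨B, hB⟩ := exists_iso_sum (h.irred t) ht
      have hd := hB.degree_eq
      rw [degree_sum] at hd
      have := h.degree_pos t
      rw [cls_iso hB, cls_sum]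
      exact Submodule.add_mem _ (Submodule.subset_span ⟨t, rfl⟩) (ih _ (by omega) B rfl)

/-- A general element is a polynomial in classes. Tensor products turn products of classes back into
classes, and the trivial representation takes care of the constants. -/
theorem mem_span (h : IsRegularFamily R)
    (x : RepRing G) : x ∈ Submodule.span ℤ (Set.range fun t => (R t).cls) := by
  obtain ⟨q, rfl⟩ := Ideal.Quotient.mk_surjective x
  induction q using MvPolynomial.induction_on with
  | C a =>
    have := Submodule.smul_mem _ a (h.cls_mem_span (triv G))
    rw [cls_triv] at this
    convert this using 1
    rw [zsmul_eq_mul, mul_one]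
    rw [eq_intCast MvPolynomial.C a, map_intCast]
  | add p q hp hq =>
    rw [map_add]
    exact Submodule.add_mem _ hp hq
  | mul_X p A hp =>
    rw [map_mul]
    change _ * A.cls ∈ _
    generalize Ideal.Quotient.mk (Ideal.span {q : MvPolynomial (CRep G) ℤ | RingRel q}) p = y
      at hp ⊢
    induction hp using Submodule.span_induction with
    | mem y hy =>
      obtain ⟨t, rfl⟩ := hy
      rw [← cls_tensor]
      exact h.cls_mem_span _
    | zero => rw [zero_mul]; exact Submodule.zero_mem _
    | add y z _ _ hy hz => rw [add_mul]; exact Submodule.add_mem _ hy hz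
    | smul a y _ hy => rw [smul_mul_assoc]; exact Submodule.smul_mem _ _ hy

/-- Pairing the relation with the character of R s isolates |G| · n s. -/
theorem eq_zero_of_sum_char (h : IsRegularFamily R)
    {n : I → ℤ} (hn : ∀ g, ∑ t, (n t : ℂ) * (R t).char g = 0) (s : I) :
    n s = 0 := by
  classical
  have h0 : (Nat.card G : ℂ) ≠ 0 := by exact_mod_cast Nat.card_pos.ne'
  have h1 : ∑ g : G, (∑ t, (n t : ℂ) * (R t).char g) * (R s).char g⁻¹ = Nat.card G * n s := by
    calc ∑ g : G, (∑ t, (n t : ℂ) * (R t).char g) * (R s).char g⁻¹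
        = ∑ t, (n t : ℂ) * ∑ g : G, (R t).char g * (R s).char g⁻¹ := by
          simp only [Finset.mul_sum, Finset.sum_mul]
          rw [Finset.sum_comm]
          exact Finset.sum_congr rfl fun _ _ => Finset.sum_congr rfl fun _ _ => by ring
      _ = _ := by
          simp only [sum_char_mul_char, h.homDim_eq]
          simp [mul_comm]
  simp only [hn, zero_mul, Finset.sum_const_zero] at h1
  exact_mod_cast (mul_eq_zero.1 h1.symm).resolve_left h0

theorem eq_zero_of_sum_cls (h : IsRegularFamily R)
    {n : I → ℤ} (hn : ∑ t, n t • (R t).cls = 0) (s : I) : n s = 0 := by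
  refine h.eq_zero_of_sum_char (fun g => ?_) s
  have := congrArg (charHom g) hn
  simpa [charHom_cls] using this

/-- Elements of the representation ring are determined by their characters. -/
theorem ext (h : IsRegularFamily R)
    {x y : RepRing G} (hxy : ∀ g, charHom g x = charHom g y) : x = y := by
  obtain ⟨n, hn⟩ := (Submodule.mem_span_range_iff_exists_fun ℤ).1 (h.mem_span (x - y))
  have : ∀ s, n s = 0 := h.eq_zero_of_sum_char fun g => by
    have h1 := congrArg (charHom g) hn
    rw [map_sub, hxy, sub_self] at h1
    simpa [charHom_cls] using h1
  simp only [this, zero_smul, Finset.sum_const_zero] at hn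
  exact sub_eq_zero.1 hn.symm

/-- Representations are determined by their characters. -/
theorem iso_of_char_eq (h : IsRegularFamily R)
    {A B : CRep G} (hAB : ∀ g, A.char g = B.char g) : A.Iso B := by
  induction hn : A.degree using Nat.strong_induction_on generalizing A B with
  | _ n ih =>
    have hd : A.degree = B.degree := by
      have := hAB 1
      rw [char_one, char_one] at this
      exact_mod_cast this
    by_cases h0 : A.degree = 0
    · have : Subsingleton A.V := Module.finrank_zero_iff.1 h0
      have : Subsingleton B.V := Module.finrank_zero_iff.1 (hd ▸ h0 : B.degree = 0)
      exact ⟨Representation.Equiv.mk (0 : A.V ≃ₗ[ℂ] B.V) fun g => LinearMap.ext fun x =>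
        Subsingleton.elim _ _⟩
    · obtain ⟨t, ht⟩ := h.exists_homDim_ne_zero h0
      -- Multiplicities depend on characters only, so the same R t splits off from A and from B; the
      -- complements again have equal characters and smaller degree.
      have ht' : homDim (R t) B ≠ 0 := by
        have h1 := sum_char_mul_char (R t) A
        have h2 := sum_char_mul_char (R t) B
        simp only [hAB] at h1
        have hc : (Nat.card G : ℂ) ≠ 0 := by exact_mod_cast Nat.card_pos.ne'
        have h3 : homDim (R t) A = homDim (R t) B := by
          exact_mod_cast mul_left_cancel₀ hc (h1.symm.trans h2)
        rwa [← h3]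
      obtain ⟨A', hA'⟩ := exists_iso_sum (h.irred t) ht
      obtain ⟨B', hB'⟩ := exists_iso_sum (h.irred t) ht'
      have hdA := hA'.degree_eq
      rw [degree_sum] at hdA
      have := h.degree_pos t
      have hAB' : A'.Iso B' := by
        refine ih A'.degree (by omega) (fun g => ?_) rfl
        have := hAB g
        rw [hA'.char_eq, hB'.char_eq, char_sum, char_sum] at this
        exact add_left_cancel this
      exact hA'.trans ((Iso.sum (Iso.refl _) hAB').trans hB'.symm)

theorem cls_eq_iff (h : IsRegularFamily R)
    {A B : CRep G} : A.cls = B.cls ↔ A.Iso B := by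
  refine ⟨fun e => h.iso_of_char_eq fun g => ?_, cls_iso⟩
  rw [← charHom_cls, ← charHom_cls, e]

end IsRegularFamily

end CRep

/-! ### The unitriangular group: coordinates, Sylow property, characters of the explicit
representations. -/

section Unitriangular

variable {p : ℕ} [Fact p.Prime]

/-- Coordinates on the group of `4 × 4` unitriangular matrices. -/
def unitriEquiv :
    unitri 4 p ≃ ZMod p × ZMod p × ZMod p × ZMod p × ZMod p × ZMod p where
  toFun g := (ent g 0 1, ent g 0 2, ent g 0 3, ent g 1 2, ent g 1 3, ent g 2 3)
  invFun t := mk4 t.1 t.2.1 t.2.2.1 t.2.2.2.1 t.2.2.2.2.1 t.2.2.2.2.2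
  left_inv g := ent_ext fun i j hij => by
    fin_cases i <;> fin_cases j <;> first | exact absurd hij (by decide) | rfl
  right_inv t := rfl

theorem mk4_ent (g : unitri 4 p) :
    mk4 (ent g 0 1) (ent g 0 2) (ent g 0 3) (ent g 1 2) (ent g 1 3) (ent g 2 3) = g :=
  unitriEquiv.left_inv g

theorem mk4_inj {u x z v y w u' x' z' v' y' w' : ZMod p} :
    mk4 u x z v y w = mk4 u' x' z' v' y' w' ↔
      u = u' ∧ x = x' ∧ z = z' ∧ v = v' ∧ y = y' ∧ w = w' :=
  (unitriEquiv.symm.injective.eq_iff (a := (u, x, z, v, y, w))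
    (b := (u', x', z', v', y', w'))).trans (by simp only [Prod.mk.injEq])

theorem mk3_ent (g : unitri 3 p) : mk3 (ent g 0 1) (ent g 1 2) (ent g 0 2) = g :=
  ent_ext fun i j hij => by
    fin_cases i <;> fin_cases j <;> first | exact absurd hij (by decide) | rfl

theorem mk4_zero : mk4 0 0 0 0 0 0 = (1 : unitri 4 p) :=
  ent_ext fun i j hij => by
    fin_cases i <;> fin_cases j <;> first | exact absurd hij (by decide) | rfl

theorem mk3_zero : mk3 0 0 0 = (1 : unitri 3 p) :=
  ent_ext fun i j hij => by
    fin_cases i <;> fin_cases j <;> first | exact absurd hij (by decide) | rfl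

instance : Fintype (unitri 4 p) := Fintype.ofEquiv _ unitriEquiv.symm

theorem card_unitri : Nat.card (unitri 4 p) = p ^ 6 := by
  rw [Nat.card_congr unitriEquiv]
  simp only [Nat.card_prod, Nat.card_zmod]
  ring

/-- The index of this subgroup of order p⁶ is the product of the p^m - 1 for m = 1, …, 4, none of
which is divisible by p. -/
theorem exists_unitri_sylow (p : ℕ) [Fact p.Prime] :
    ∃ P : Sylow p (GL (Fin 4) (ZMod p)), P.toSubgroup = unitri 4 p := by
  have hp : p.Prime := Fact.out
  have hG : Nat.card (GL (Fin 4) (ZMod p)) =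
      p ^ 6 * ((p ^ 4 - 1) * (p ^ 3 - 1) * (p ^ 2 - 1) * (p - 1)) := by
    rw [Matrix.card_GL_field]
    simp only [Fin.prod_univ_four, ZMod.card, Fin.val_zero, Fin.val_one, Fin.val_two, pow_zero]
    have h3 : ((3 : Fin 4) : ℕ) = 3 := rfl
    have e1 : p ^ 4 - p ^ 1 = p * (p ^ 3 - 1) := by rw [Nat.mul_sub]; ring_nf
    have e2 : p ^ 4 - p ^ 2 = p ^ 2 * (p ^ 2 - 1) := by rw [Nat.mul_sub]; ring_nf
    have e3 : p ^ 4 - p ^ 3 = p ^ 3 * (p - 1) := by rw [Nat.mul_sub]; ring_nf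
    rw [h3, e1, e2, e3]
    ring
  have hnd : ∀ m, m ≠ 0 → ¬ p ∣ p ^ m - 1 := fun m hm h => by
    have h1 : p ∣ p ^ m := dvd_pow_self p hm
    have h2 : p ∣ 1 := by
      have := Nat.dvd_sub h1 h
      rwa [Nat.sub_sub_self (Nat.one_le_pow _ _ hp.pos)] at this
    exact hp.one_lt.ne' (Nat.dvd_one.1 h2)
  have hpg : IsPGroup p (unitri 4 p) := IsPGroup.of_card card_unitri
  refine ⟨hpg.toSylow ?_, rfl⟩
  have h1 := (unitri 4 p).card_mul_index
  rw [card_unitri, hG] at h1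
  rw [Nat.eq_of_mul_eq_mul_left (pow_pos hp.pos 6) h1]
  have h4 := hnd 1 one_ne_zero
  rw [pow_one] at h4
  simp only [hp.dvd_mul, not_or]
  exact ⟨⟨⟨hnd 4 (by decide), hnd 3 (by decide)⟩, hnd 2 (by decide)⟩, h4⟩

/-- Orthogonality of additive characters; the character sums below collapse through it. -/
theorem sum_zeta_mul (b : ZMod p) : ∑ x, zeta (x * b) = if b = 0 then (p : ℂ) else 0 := by
  have := AddChar.sum_mulShift b (ZMod.isPrimitive_stdAddChar p)
  rw [ZMod.card] at this
  exact_mod_cast this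

theorem zeta_injective : Function.Injective (zeta : ZMod p → ℂ) := ZMod.injective_stdAddChar

theorem natCast_prime_ne_zero : (p : ℂ) ≠ 0 := by
  exact_mod_cast (Fact.out : p.Prime).ne_zero

theorem sum_units {M : Type*} [AddCommGroup M] (f : ZMod p → M) :
    ∑ i : (ZMod p)ˣ, f i = ∑ i, f i - f 0 := by
  rw [eq_sub_iff_add_eq, ← Finset.sum_erase_add _ _ (Finset.mem_univ (0 : ZMod p))]
  congr 1
  refine Finset.sum_bij (fun i _ => (i : ZMod p)) (by simp) (fun _ _ _ _ h => Units.ext h)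
    (fun b hb => ?_) (fun _ _ => rfl)
  exact ⟨Units.mk0 b (Finset.ne_of_mem_erase hb), Finset.mem_univ _, rfl⟩

theorem sum_units_zeta (b : ZMod p) :
    ∑ i : (ZMod p)ˣ, zeta (-(i * b) : ZMod p) = (if b = 0 then (p : ℂ) else 0) - 1 := by
  rw [sum_units (fun i => zeta (-(i * b)))]
  simp only [← mul_neg, sum_zeta_mul, neg_eq_zero, zero_mul, neg_zero, zeta_zero]

theorem trace_pi {ι : Type*} [Fintype ι] [DecidableEq ι] (f : (ι → ℂ) →ₗ[ℂ] (ι → ℂ)) :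
    LinearMap.trace ℂ (ι → ℂ) f = ∑ j, f (Pi.single j 1) j := by
  rw [LinearMap.trace_eq_matrix_trace ℂ (Pi.basisFun ℂ ι)]
  simp [Matrix.trace]

open CRep

theorem char_fRep (a b c : ZMod p) (g : unitri 4 p) :
    (fRep a b c).char g = zeta (a * ent g 0 1 + b * ent g 1 2 + c * ent g 2 3) :=
  char_ofChar _ _

/-- A nonzero shift moves every basis vector and has zero diagonal. Without shift, the diagonal
entries form a character sum over j, which vanishes unless g₂₃ = 0. -/
theorem char_heisRep {k : ZMod p} (hk : k ≠ 0) (g : unitri 3 p) :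
    (heisRep k).char g =
      if ent g 0 1 = 0 ∧ ent g 1 2 = 0 then (p : ℂ) * zeta (-(k * ent g 0 2)) else 0 := by
  have h : (heisRep k).char g = ∑ j : ZMod p, zeta (k * (j * ent g 1 2 - ent g 0 2)) *
      (Pi.single j (1 : ℂ) : ZMod p → ℂ) (j - ent g 0 1) := trace_pi (ι := ZMod p) _
  rw [h]
  by_cases h1 : ent g 0 1 = 0
  · have h2 : ∀ j, zeta (k * (j * ent g 1 2 - ent g 0 2)) *
        (Pi.single j (1 : ℂ) : ZMod p → ℂ) (j - ent g 0 1) =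
        zeta (j * (k * ent g 1 2)) * zeta (-(k * ent g 0 2)) := fun j => by
      rw [h1, sub_zero, Pi.single_eq_same, mul_one, ← zeta_add]
      congr 1
      ring
    rw [Finset.sum_congr rfl fun j _ => h2 j]
    simp only [← Finset.sum_mul, sum_zeta_mul, mul_eq_zero, hk, false_or, h1, true_and]
    split_ifs <;> simp
  · rw [if_neg (fun h => h1 h.1)]
    refine Finset.sum_eq_zero fun j _ => ?_
    rw [Pi.single_eq_of_ne (fun h => h1 (by simpa using h)), mul_zero]

/-- The quadratic correction in the retraction contains the factor g₂₃ (`ent g 1 2`), which is zero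
on the support of the character. -/
theorem char_phiInf {i : ZMod p} (hi : i ≠ 0) (l : ZMod p) (g : unitri 4 p) :
    (phiInf i l).char g = if ent g 0 1 = l * ent g 2 3 ∧ ent g 1 2 = 0 then
      (p : ℂ) * zeta (-(i * (ent g 0 2 + l * ent g 1 3))) else 0 := by
  refine (char_heisRep hi (retrInf l g)).trans ?_
  have h1 : ent (retrInf l g) 0 1 = ent g 0 1 - l * ent g 2 3 := rfl
  have h2 : ent (retrInf l g) 1 2 = ent g 1 2 := rfl
  have h3 : ent (retrInf l g) 0 2 =
    ent g 0 2 + l * (ent g 1 3 - ent g 1 2 * ent g 2 3) := rfl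
  refine ite_congr (by rw [h1, h2, sub_eq_zero]) (fun h => ?_) fun _ => rfl
  rw [h3, h.2, zero_mul, sub_zero]

theorem char_phiZero {i : ZMod p} (hi : i ≠ 0) (m : ZMod p) (g : unitri 4 p) :
    (phiZero i m).char g = if ent g 1 2 = 0 ∧ ent g 2 3 = m * ent g 0 1 then
      (p : ℂ) * zeta (-(i * (ent g 1 3 + m * ent g 0 2))) else 0 := by
  refine (char_heisRep hi (retrZero m g)).trans ?_
  have h1 : ent (retrZero m g) 0 1 = ent g 1 2 := rfl
  have h2 : ent (retrZero m g) 1 2 = ent g 2 3 - m * ent g 0 1 := rfl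
  have h3 : ent (retrZero m g) 0 2 =
    ent g 1 3 + m * (ent g 0 2 - ent g 0 1 * ent g 1 2) := rfl
  refine ite_congr (by rw [h1, h2, sub_eq_zero]) (fun h => ?_) fun _ => rfl
  rw [h3, h.1, mul_zero, sub_zero]

theorem char_phi_coe {i : ZMod p} (hi : i ≠ 0) (l : ZMod p) (g : unitri 4 p) :
    (phi i l).char g = if ent g 0 1 = l * ent g 2 3 ∧ ent g 1 2 = 0 then
      (p : ℂ) * zeta (-(i * (ent g 0 2 + l * ent g 1 3))) else 0 :=
  char_phiInf hi l g

theorem char_phi_infty {i : ZMod p} (hi : i ≠ 0) (g : unitri 4 p) :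
    (phi i OnePoint.infty).char g = if ent g 1 2 = 0 ∧ ent g 2 3 = 0 then
      (p : ℂ) * zeta (-(i * ent g 1 3)) else 0 := by
  refine (char_phiZero hi 0 g).trans ?_
  simp only [zero_mul, add_zero]

/-- If g₁₂ or g₃₄ is nonzero, every basis vector is moved. Otherwise the sum over j imposes i g₂₃ +
g₂₄ = 0. For g₂₃ ≠ 0 this singles out i = -g₂₄/g₂₃ and leaves one term of size p; for g₂₃ = 0 it
requires g₂₄ = 0, and then the sum over i requires g₁₃ = 0. -/
theorem char_psiRep {k : ZMod p} (hk : k ≠ 0) (g : unitri 4 p) :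
    (psiRep k).char g = if ent g 0 1 = 0 ∧ ent g 2 3 = 0 then
      (if ent g 1 2 = 0 then
        (if ent g 0 2 = 0 ∧ ent g 1 3 = 0 then (p : ℂ) ^ 2 * zeta (-(k * ent g 0 3)) else 0)
      else (p : ℂ) * zeta (k * (ent g 0 2 * ent g 1 3 / ent g 1 2 - ent g 0 3))) else 0 := by
  have h : (psiRep k).char g = ∑ t : ZMod p × ZMod p,
      zeta (k * ((t.1 - ent g 2 3) * t.2 * ent g 1 2 + t.2 * ent g 1 3
              - (t.1 - ent g 2 3) * ent g 0 2 - ent g 0 3)) *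
      (Pi.single t (1 : ℂ) : ZMod p × ZMod p → ℂ) (t.1 - ent g 2 3, t.2 - ent g 0 1) :=
    trace_pi (ι := ZMod p × ZMod p) _
  rw [h]
  by_cases h1 : ent g 0 1 = 0 ∧ ent g 2 3 = 0
  · have h2 : ∀ t : ZMod p × ZMod p,
        zeta (k * ((t.1 - ent g 2 3) * t.2 * ent g 1 2 + t.2 * ent g 1 3
              - (t.1 - ent g 2 3) * ent g 0 2 - ent g 0 3)) *
        (Pi.single t (1 : ℂ) : ZMod p × ZMod p → ℂ) (t.1 - ent g 2 3, t.2 - ent g 0 1) =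
        zeta (-(k * (t.1 * ent g 0 2 + ent g 0 3))) *
          zeta (t.2 * (k * (t.1 * ent g 1 2 + ent g 1 3))) := fun t => by
      rw [h1.1, h1.2, sub_zero, sub_zero, Pi.single_eq_same, mul_one, ← zeta_add]
      congr 1
      ring
    simp only [h2, Fintype.sum_prod_type, ← Finset.mul_sum, sum_zeta_mul, mul_eq_zero, hk, false_or]
    rw [if_pos h1]
    by_cases hv : ent g 1 2 = 0
    · simp only [hv, mul_zero, zero_add, if_true]
      by_cases hy : ent g 1 3 = 0
      · simp only [hy, if_true, and_true, ← Finset.sum_mul]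
        have h3 : ∀ i : ZMod p, zeta (-(k * (i * ent g 0 2 + ent g 0 3))) =
            zeta (i * (-(k * ent g 0 2))) * zeta (-(k * ent g 0 3)) := fun i => by
          rw [← zeta_add]
          congr 1
          ring
        simp only [h3, ← Finset.sum_mul, sum_zeta_mul, neg_eq_zero, mul_eq_zero, hk, false_or]
        split_ifs
        · ring
        · simp
      · simp [hy]
    · rw [if_neg hv, Finset.sum_eq_single (-(ent g 1 3 / ent g 1 2))]
      · rw [if_pos (by field_simp; ring), mul_comm]
        congr 2
        field_simp
        ring
      · intro i _ hi
        rw [if_neg, mul_zero]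
        intro h0
        apply hi
        rw [← neg_div, eq_div_iff hv]
        exact eq_neg_of_add_eq_zero_left h0
      · simp
  · rw [if_neg h1]
    refine Finset.sum_eq_zero fun t _ => ?_
    rw [Pi.single_eq_of_ne, mul_zero]
    intro h0
    have h3 := congrArg Prod.fst h0
    have h4 := congrArg Prod.snd h0
    simp only [sub_eq_self] at h3 h4
    exact h1 ⟨h4, h3⟩

theorem degree_fRep (a b c : ZMod p) : (fRep a b c).degree = 1 := degree_ofChar _

theorem degree_heisRep (k : ZMod p) : (heisRep k).degree = p := by
  have : (heisRep k).degree = Module.finrank ℂ (ZMod p → ℂ) := rfl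
  rw [this, Module.finrank_fintype_fun_eq_card, ZMod.card]

theorem degree_phi (i : ZMod p) (l : OnePoint (ZMod p)) : (phi i l).degree = p := by
  induction l using OnePoint.rec with
  | infty => exact degree_heisRep i
  | coe l => exact degree_heisRep i

theorem degree_psiRep (k : ZMod p) : (psiRep k).degree = p ^ 2 := by
  have : (psiRep k).degree = Module.finrank ℂ (ZMod p × ZMod p → ℂ) := rfl
  rw [this, Module.finrank_fintype_fun_eq_card, Fintype.card_prod, ZMod.card, sq]

end Unitriangular

/-! ### The list of representations decomposes the regular character. -/

section RegularFamily

variable {p : ℕ} [Fact p.Prime]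

/-- The index set of the irreducible representations as a disjoint union of products. -/
def irrIndexEquiv : IrrIndex p ≃
    ((ZMod p × ZMod p × ZMod p) ⊕ (ZMod p × (ZMod p)ˣ × ZMod p)) ⊕
      ((ZMod p × (ZMod p)ˣ) ⊕ (ZMod p × (ZMod p)ˣ)) where
  toFun
    | .lin a b c => .inl (.inl (a, b, c))
    | .mid a i l => .inl (.inr (a, i, l))
    | .midInf a i => .inr (.inl (a, i))
    | .top a k => .inr (.inr (a, k))
  invFun
    | .inl (.inl t) => .lin t.1 t.2.1 t.2.2
    | .inl (.inr t) => .mid t.1 t.2.1 t.2.2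
    | .inr (.inl t) => .midInf t.1 t.2
    | .inr (.inr t) => .top t.1 t.2
  left_inv := by rintro (_ | _ | _ | _) <;> rfl
  right_inv := by rintro ((_ | _) | (_ | _)) <;> rfl

instance : Fintype (IrrIndex p) := Fintype.ofEquiv _ irrIndexEquiv.symm

theorem sum_irrIndex {M : Type*} [AddCommMonoid M] (F : IrrIndex p → M) :
    ∑ t, F t = ((∑ a, ∑ b, ∑ c, F (.lin a b c)) + ∑ a, ∑ i, ∑ l, F (.mid a i l)) +
      ((∑ a, ∑ i, F (.midInf a i)) + ∑ a, ∑ k, F (.top a k)) := by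
  rw [← irrIndexEquiv.symm.sum_comp]
  simp only [Fintype.sum_sum_type, Fintype.sum_prod_type]
  rfl

open CRep

theorem zmodUnit_ne_zero (i : (ZMod p)ˣ) : (i : ZMod p) ≠ 0 := i.ne_zero

theorem irrRep_degree (t : IrrIndex p) : (irrRep t).degree =
    match t with
    | .lin _ _ _ => 1
    | .mid _ _ _ => p
    | .midInf _ _ => p
    | .top _ _ => p ^ 2 := by
  cases t <;> simp [irrRep, degree_tensor, degree_fRep, degree_phi, degree_psiRep]

/-- In this and the next three sums, summing over the linear twists adds the vanishing that the
characters lack by themselves: each family contributes only on the subgroup g₁₂ = g₂₃ = g₃₄ = 0. -/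
theorem sum_char_lin (g : unitri 4 p) :
    ∑ a : ZMod p, ∑ b : ZMod p, ∑ c : ZMod p, (fRep a b c).char g =
      if ent g 0 1 = 0 ∧ ent g 1 2 = 0 ∧ ent g 2 3 = 0 then (p : ℂ) ^ 3 else 0 := by
  simp only [char_fRep, zeta_add, ← Finset.mul_sum, ← Finset.sum_mul, sum_zeta_mul]
  split_ifs <;> simp_all
  ring

theorem sum_char_mid (g : unitri 4 p) :
    ∑ a : ZMod p, ∑ i : (ZMod p)ˣ, ∑ l : ZMod p, ((fRep 0 0 a).tensor (phi i l)).char g =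
      if ent g 0 1 = 0 ∧ ent g 1 2 = 0 ∧ ent g 2 3 = 0 then
        (p : ℂ) ^ 2 * ∑ l : ZMod p, ((if ent g 0 2 + l * ent g 1 3 = 0 then (p : ℂ) else 0) - 1)
      else 0 := by
  simp only [char_tensor, char_fRep, zero_mul, zero_add, char_phi_coe (zmodUnit_ne_zero _),
    ← Finset.mul_sum, ← Finset.sum_mul, sum_zeta_mul]
  by_cases hw : ent g 2 3 = 0
  · by_cases huv : ent g 0 1 = 0 ∧ ent g 1 2 = 0
    · simp only [huv.1, huv.2, hw, mul_zero, and_self, if_true, ← Finset.mul_sum]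
      rw [Finset.sum_comm]
      simp only [sum_units_zeta]
      ring
    · simp only [hw, mul_zero, huv, if_false, Finset.sum_const_zero, and_true]
  · simp [hw]

theorem sum_char_midInf (g : unitri 4 p) :
    ∑ a : ZMod p, ∑ i : (ZMod p)ˣ, ((fRep a 0 0).tensor (phi i OnePoint.infty)).char g =
      if ent g 0 1 = 0 ∧ ent g 1 2 = 0 ∧ ent g 2 3 = 0 then
        (p : ℂ) ^ 2 * ((if ent g 1 3 = 0 then (p : ℂ) else 0) - 1)
      else 0 := by
  simp only [char_tensor, char_fRep, zero_mul, add_zero, char_phi_infty (zmodUnit_ne_zero _),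
    ← Finset.mul_sum, ← Finset.sum_mul, sum_zeta_mul]
  by_cases hu : ent g 0 1 = 0
  · by_cases hvw : ent g 1 2 = 0 ∧ ent g 2 3 = 0
    · simp only [hvw.1, hvw.2, hu, and_self, if_true, ← Finset.mul_sum, sum_units_zeta]
      ring
    · simp only [hvw, if_false, Finset.sum_const_zero, mul_zero, and_false]
  · simp [hu]

theorem sum_char_top (g : unitri 4 p) :
    ∑ a : ZMod p, ∑ k : (ZMod p)ˣ, ((fRep 0 a 0).tensor (psiRep k)).char g =
      if ent g 0 1 = 0 ∧ ent g 1 2 = 0 ∧ ent g 2 3 = 0 then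
        if ent g 0 2 = 0 ∧ ent g 1 3 = 0 then
          (p : ℂ) ^ 3 * ((if ent g 0 3 = 0 then (p : ℂ) else 0) - 1)
        else 0
      else 0 := by
  simp only [char_tensor, char_fRep, zero_mul, add_zero, zero_add, char_psiRep (zmodUnit_ne_zero _),
    ← Finset.mul_sum, ← Finset.sum_mul, sum_zeta_mul]
  by_cases hv : ent g 1 2 = 0
  · by_cases huw : ent g 0 1 = 0 ∧ ent g 2 3 = 0
    · simp only [huw.1, huw.2, hv, and_self, if_true]
      by_cases hxy : ent g 0 2 = 0 ∧ ent g 1 3 = 0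
      · simp only [hxy, and_self, if_true, ← Finset.mul_sum, sum_units_zeta]
        ring
      · simp only [hxy, if_false, Finset.sum_const_zero, mul_zero]
    · rw [if_neg (fun h : ent g 0 1 = 0 ∧ ent g 1 2 = 0 ∧ ent g 2 3 = 0 => huw ⟨h.1, h.2.2⟩)]
      simp only [huw, if_false, Finset.sum_const_zero, mul_zero]
  · simp [hv]

/-- On the subgroup g₁₂ = g₂₃ = g₃₄ = 0 there are three cases. If (g₁₃, g₂₄) ≠ 0, the ψ_k contribute
nothing, and exactly one ℓ ∈ 𝔽_p ∪ {∞} has its linear form in (g₁₃, g₂₄) equal to zero; the φ then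
cancel the p³ linear characters. If only g₁₄ ≠ 0, the ψ_k contribute -p⁵, which cancels all the
rest. The squares of the degrees add up to p³ + p⁴(p-1) + p³(p-1) + p⁵(p-1) = p⁶. -/
theorem irrRep_isRegularFamily : IsRegularFamily (irrRep : IrrIndex p → CRep (unitri 4 p)) where
  degree_pos t := by
    have hp : 0 < p := (Fact.out : p.Prime).pos
    rw [irrRep_degree]
    cases t <;> simp only [] <;> positivity
  sum_eq g hg := by
    rw [sum_irrIndex]
    simp only [irrRep_degree, ← Finset.mul_sum]
    simp only [irrRep, sum_char_lin, sum_char_mid, sum_char_midInf, sum_char_top]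
    by_cases h : ent g 0 1 = 0 ∧ ent g 1 2 = 0 ∧ ent g 2 3 = 0
    · simp only [if_pos h]
      by_cases hy : ent g 1 3 = 0
      · by_cases hx : ent g 0 2 = 0
        · have hz : ent g 0 3 ≠ 0 := fun hz => hg <| by
            rw [← mk4_ent g, h.1, h.2.1, h.2.2, hy, hx, hz, mk4_zero]
          simp only [hy, hx, hz, mul_zero, add_zero, if_true, if_false, and_self,
            Finset.sum_const, Finset.card_univ, ZMod.card, nsmul_eq_mul]
          push_cast
          ring
        · simp only [hy, hx, mul_zero, add_zero, if_true, if_false, false_and,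
            Finset.sum_const, Finset.card_univ, ZMod.card, nsmul_eq_mul]
          push_cast
          ring
      -- The single root ℓ = -g₁₃/g₂₄ contributes p, against p summands -1.
      · have hl : ∑ l : ZMod p, ((if ent g 0 2 + l * ent g 1 3 = 0 then (p : ℂ) else 0) - 1) =
            0 := by
          rw [Finset.sum_sub_distrib, Finset.sum_eq_single (-(ent g 0 2 / ent g 1 3))]
          · rw [if_pos (by field_simp; ring)]
            simp
          · intro l _ hl
            rw [if_neg]
            intro h0
            apply hl
            rw [← neg_div, eq_div_iff hy]
            exact eq_neg_of_add_eq_zero_right h0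
          · simp
        simp only [hl, hy, and_false, if_false]
        push_cast
        ring
    · simp only [if_neg h, mul_zero, add_zero]
  sum_sq := by
    rw [sum_irrIndex, card_unitri]
    simp only [irrRep_degree, Finset.sum_const, Finset.card_univ, ZMod.card,
      ZMod.card_units_eq_totient,
      Nat.totient_prime (Fact.out : p.Prime), smul_eq_mul]
    obtain ⟨q, hq⟩ := Nat.exists_eq_add_of_lt (Fact.out : p.Prime).pos
    rw [zero_add] at hq
    rw [hq, Nat.add_sub_cancel]
    ring

end RegularFamily

/-! ### Counting conjugacy classes through commuting pairs. -/

section ConjugacyClasses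

variable {p : ℕ} [Fact p.Prime]

theorem sum_indicator_eq_mul (v v' : ZMod p) :
    ∑ u : ZMod p, ∑ u' : ZMod p, (if u * v' = u' * v then (1 : ℂ) else 0) =
      if v = 0 ∧ v' = 0 then (p : ℂ) ^ 2 else p := by
  by_cases hv : v = 0
  · by_cases hv' : v' = 0
    · simp [hv, hv', sq]
    · simp [hv, hv']
  · have h : ∀ u u' : ZMod p, u * v' = u' * v ↔ u * v' / v = u' := fun u u' => by
      rw [div_eq_iff hv]
    simp [h, hv]

/-- A linear form on 𝔽_p⁴ has p³ zeros, or p⁴ if it is the zero form. The indicator is expanded as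
an average of additive characters. -/
theorem sum_indicator_functional (a b c d : ZMod p) :
    ∑ t : ZMod p × ZMod p × ZMod p × ZMod p,
      (if t.1 * a + t.2.1 * b + t.2.2.1 * c + t.2.2.2 * d = 0 then (1 : ℂ) else 0) =
      (p : ℂ) ^ 3 + if a = 0 ∧ b = 0 ∧ c = 0 ∧ d = 0 then (p : ℂ) ^ 4 - p ^ 3 else 0 := by
  have hp := natCast_prime_ne_zero (p := p)
  refine mul_left_cancel₀ hp ?_
  have h1 : ∀ t : ZMod p × ZMod p × ZMod p × ZMod p, (p : ℂ) *
      (if t.1 * a + t.2.1 * b + t.2.2.1 * c + t.2.2.2 * d = 0 then (1 : ℂ) else 0) =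
      ∑ s : ZMod p, zeta (t.1 * (s * a)) * zeta (t.2.1 * (s * b)) * zeta (t.2.2.1 * (s * c)) *
        zeta (t.2.2.2 * (s * d)) := fun t => by
    rw [mul_ite, mul_one, mul_zero, ← sum_zeta_mul]
    refine Finset.sum_congr rfl fun s _ => ?_
    rw [← zeta_add, ← zeta_add, ← zeta_add]
    congr 1
    ring
  rw [Finset.mul_sum, Finset.sum_congr rfl fun t _ => h1 t, Finset.sum_comm]
  simp only [Fintype.sum_prod_type, ← Finset.mul_sum, ← Finset.sum_mul, sum_zeta_mul]
  by_cases h : a = 0 ∧ b = 0 ∧ c = 0 ∧ d = 0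
  · obtain ⟨rfl, rfl, rfl, rfl⟩ := h
    simp only [mul_zero, and_self, if_true, Finset.sum_const, Finset.card_univ, ZMod.card,
      nsmul_eq_mul]
    ring
  · rw [if_neg h, Finset.sum_eq_single 0]
    · simp
      ring
    · intro s _ hs
      simp only [mul_eq_zero, hs, false_or]
      by_contra hne
      apply h
      refine ⟨?_, ?_, ?_, ?_⟩ <;> by_contra h0 <;> exact hne (by simp [h0])
    · simp

/-- Two collinearity conditions on the superdiagonal entries and, once these entries are fixed, one
linear equation in the (1,3) and (2,4) entries; the corners are free. -/
theorem mk4_commute_iff (u x z v y w u' x' z' v' y' w' : ZMod p) :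
    Commute (mk4 u x z v y w) (mk4 u' x' z' v' y' w') ↔
      u * v' = u' * v ∧ w * v' = w' * v ∧ x * w' + x' * (-w) + y * (-u') + y' * u = 0 := by
  rw [Commute, SemiconjBy, mk4_mul, mk4_mul, mk4_inj]
  constructor
  · rintro ⟨-, h2, h3, -, h5, -⟩
    exact ⟨by linear_combination h2, by linear_combination -h5, by linear_combination h3⟩
  · rintro ⟨h1, h2, h3⟩
    exact ⟨add_comm _ _, by linear_combination h1, by linear_combination h3, add_comm _ _,
      by linear_combination -h2, add_comm _ _⟩

/-- Coordinates on pairs of `4 × 4` unitriangular matrices. -/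
def unitriPairEquiv : ((((ZMod p × ZMod p) × (ZMod p × ZMod p)) × (ZMod p × ZMod p)) ×
    (ZMod p × ZMod p × ZMod p × ZMod p)) × (ZMod p × ZMod p) ≃ unitri 4 p × unitri 4 p where
  toFun t :=
    (mk4 t.1.1.1.2.1 t.1.2.1 t.2.1 t.1.1.1.1.1 t.1.2.2.2.1 t.1.1.2.1,
      mk4 t.1.1.1.2.2 t.1.2.2.1 t.2.2 t.1.1.1.1.2 t.1.2.2.2.2 t.1.1.2.2)
  invFun g := (((((ent g.1 1 2, ent g.2 1 2), (ent g.1 0 1, ent g.2 0 1)),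
    (ent g.1 2 3, ent g.2 2 3)), (ent g.1 0 2, ent g.2 0 2, ent g.1 1 3, ent g.2 1 3)),
    (ent g.1 0 3, ent g.2 0 3))
  left_inv _ := rfl
  right_inv g := Prod.ext (mk4_ent g.1) (mk4_ent g.2)

/-- The indicator function of proportionality of two vectors. -/
noncomputable def collinearInd (q s : ZMod p × ZMod p) : ℂ :=
  if s.1 * q.2 = s.2 * q.1 then 1 else 0

/-- The indicator function of the zero vector. -/
noncomputable def zeroInd (s : ZMod p × ZMod p) : ℂ := if s = 0 then 1 else 0

theorem sum_zeroInd : ∑ s : ZMod p × ZMod p, zeroInd s = 1 := by simp [zeroInd]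

theorem sum_collinearInd (q : ZMod p × ZMod p) :
    ∑ s, collinearInd q s = p + ((p : ℂ) ^ 2 - p) * zeroInd q := by
  unfold collinearInd zeroInd
  rw [Fintype.sum_prod_type, sum_indicator_eq_mul]
  by_cases h : q = 0
  · simp [h]
  · rw [if_neg h, mul_zero, add_zero, if_neg]
    rintro ⟨h1, h2⟩
    exact h (Prod.ext h1 h2)

/-- Let q, s, r ∈ 𝔽_p² collect the (2,3), (1,2) and (3,4) entries of the two matrices. The corners
contribute p²; s and r must be collinear with q; the remaining linear form has the entries of r and
s, up to sign and order, as coefficients, hence p³ zeros, or p⁴ if s = r = 0. The number of s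
collinear with q is p, or p² for q = 0, and the squares of these numbers sum to 2p⁴ - p². -/
theorem card_commute : (Nat.card {g : unitri 4 p × unitri 4 p // Commute g.1 g.2} : ℂ) =
    p ^ 5 * (2 * p ^ 4 - p ^ 2) + p ^ 8 - p ^ 7 := by
  classical
  rw [Nat.card_eq_fintype_card, Fintype.card_subtype, Finset.card_filter, Nat.cast_sum,
    ← unitriPairEquiv.sum_comp]
  let H : (((ZMod p × ZMod p) × (ZMod p × ZMod p)) × (ZMod p × ZMod p)) →
      (ZMod p × ZMod p × ZMod p × ZMod p) → ℂ := fun t s =>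
    if s.1 * t.2.2 + s.2.1 * (-t.2.1) + s.2.2.1 * (-t.1.2.2) + s.2.2.2 * t.1.2.1 = 0
      then 1 else 0
  have h1 : ∀ t, (((if Commute (unitriPairEquiv (p := p) t).1 (unitriPairEquiv t).2
      then 1 else 0 : ℕ)) : ℂ) = collinearInd t.1.1.1.1 t.1.1.1.2 *
        collinearInd t.1.1.1.1 t.1.1.2 * H t.1.1 t.1.2 := fun t =>
    (congrArg Nat.cast (if_congr (mk4_commute_iff t.1.1.1.2.1 t.1.2.1 t.2.1 t.1.1.1.1.1
      t.1.2.2.2.1 t.1.1.2.1 t.1.1.1.2.2 t.1.2.2.1 t.2.2 t.1.1.1.1.2 t.1.2.2.2.2 t.1.1.2.2)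
      rfl rfl)).trans (by simp only [collinearInd, H]; split_ifs <;> simp_all)
  have hH : ∀ t, ∑ s, H t s =
      (p : ℂ) ^ 3 + ((p : ℂ) ^ 4 - p ^ 3) * (zeroInd t.1.2 * zeroInd t.2) := fun t => by
    refine (sum_indicator_functional _ _ _ _).trans ?_
    simp only [zeroInd, Prod.ext_iff, Prod.fst_zero, Prod.snd_zero, neg_eq_zero]
    split_ifs <;> simp_all
  -- The zero vector is collinear with every q, so the correction for s = r = 0 enters for all p²
  -- values of q.
  have hz : ∀ q s : ZMod p × ZMod p, collinearInd q s * zeroInd s = zeroInd s := fun q s => by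
    unfold collinearInd zeroInd
    split_ifs <;> simp_all
  have hq : ∀ q : ZMod p × ZMod p, ((p : ℂ) + ((p : ℂ) ^ 2 - p) * zeroInd q) *
      (p + ((p : ℂ) ^ 2 - p) * zeroInd q) = p ^ 2 + ((p : ℂ) ^ 4 - p ^ 2) * zeroInd q :=
    fun q => by
      unfold zeroInd
      split_ifs <;> ring
  rw [Finset.sum_congr rfl fun t _ => h1 t]
  calc _ = (p : ℂ) ^ 2 * ∑ q : ZMod p × ZMod p, ∑ s, ∑ r, collinearInd q s * collinearInd q r *
        ((p : ℂ) ^ 3 + ((p : ℂ) ^ 4 - p ^ 3) * (zeroInd s * zeroInd r)) := by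
        rw [Fintype.sum_prod_type]
        simp only [Finset.sum_const, Finset.card_univ, Fintype.card_prod, ZMod.card,
          nsmul_eq_mul, ← Finset.mul_sum]
        rw [Fintype.sum_prod_type]
        simp only [← Finset.mul_sum, hH]
        rw [Fintype.sum_prod_type, Fintype.sum_prod_type]
        push_cast
        ring
    _ = (p : ℂ) ^ 2 * ∑ q : ZMod p × ZMod p, ((p : ℂ) ^ 3 * ((∑ s, collinearInd q s) *
        ∑ r, collinearInd q r) + ((p : ℂ) ^ 4 - p ^ 3) * ((∑ s, zeroInd (p := p) s) *
          ∑ r, zeroInd (p := p) r)) := by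
        congr 1
        refine Finset.sum_congr rfl fun q _ => ?_
        rw [Finset.sum_mul_sum, Finset.sum_mul_sum, Finset.mul_sum, Finset.mul_sum,
          ← Finset.sum_add_distrib]
        refine Finset.sum_congr rfl fun s _ => ?_
        rw [Finset.mul_sum, Finset.mul_sum, ← Finset.sum_add_distrib]
        refine Finset.sum_congr rfl fun r _ => ?_
        linear_combination ((p : ℂ) ^ 4 - p ^ 3) * collinearInd q r * zeroInd r * hz q s +
          ((p : ℂ) ^ 4 - p ^ 3) * zeroInd s * hz q r
    _ = _ := by
        simp only [sum_collinearInd, hq, sum_zeroInd, Finset.sum_add_distrib, ← Finset.mul_sum,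
          Finset.sum_const, Finset.card_univ, Fintype.card_prod, ZMod.card, nsmul_eq_mul]
        push_cast
        ring

/-- The number of commuting pairs is |G| times the number of classes. -/
theorem card_conjClasses : Nat.card (ConjClasses (unitri 4 p)) =
    p * (p - 1) + p * (p + 1) * (p - 1) + p ^ 3 := by
  have hp := natCast_prime_ne_zero (p := p)
  have h := card_commute (p := p)
  rw [card_comm_eq_card_conjClasses_mul_card, card_unitri] at h
  have h1 : 1 ≤ p := (Fact.out : p.Prime).pos
  have h2 : (Nat.card (ConjClasses (unitri 4 p)) : ℂ) =
      ((p * (p - 1) + p * (p + 1) * (p - 1) + p ^ 3 : ℕ) : ℂ) := by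
    refine mul_right_cancel₀ (pow_ne_zero 6 hp) ?_
    push_cast [h1] at h ⊢
    rw [h]
    ring
  exact_mod_cast h2

end ConjugacyClasses

/-! ### Consequences for every prime: linear characters, kernels, stabilizers, orbits. -/

section AllPrimes

variable {p : ℕ} [Fact p.Prime]

open CRep

theorem CRep.ofChar_irred {G : Type} [Group G] [Finite G] (χ : G →* ℂˣ) : (ofChar χ).Irred := by
  have := Fintype.ofFinite G
  refine irred_of_homDim_self ?_
  have h := sum_char_mul_char (ofChar χ) (ofChar χ)
  have h0 : (Nat.card G : ℂ) ≠ 0 := by exact_mod_cast Nat.card_pos.ne'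
  have h1 : ∀ g, (ofChar χ).char g * (ofChar χ).char g⁻¹ = 1 := fun g => by
    rw [char_ofChar, char_ofChar, ← Units.val_mul, ← map_mul, mul_inv_cancel, map_one,
      Units.val_one]
  simp only [h1, Finset.sum_const, Finset.card_univ, ← Nat.card_eq_fintype_card, nsmul_eq_mul]
    at h
  exact_mod_cast (mul_left_cancel₀ h0 h).symm

theorem fRep_injective {a b c a' b' c' : ZMod p} (h : (fRep a b c).Iso (fRep a' b' c')) :
    a = a' ∧ b = b' ∧ c = c' := by
  have := irrRep_isRegularFamily.eq_of_iso (s := .lin a b c) (t := .lin a' b' c') h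
  simpa using this

/-- A homomorphism to ℂˣ is an irreducible representation of degree 1, and in the complete list only
the f_{(a,b,c)} have that degree, since p > 1. -/
theorem linChar_bijective :
    Function.Bijective (fun t : ZMod p × ZMod p × ZMod p => linChar t.1 t.2.1 t.2.2) := by
  constructor
  · rintro ⟨a, b, c⟩ ⟨a', b', c'⟩ h
    have h1 : (fRep a b c).Iso (fRep a' b' c') := by
      have : linChar a b c = linChar a' b' c' := h
      rw [fRep, fRep, this]
      exact Iso.refl _
    obtain ⟨rfl, rfl, rfl⟩ := fRep_injective h1
    rfl
  · intro χ
    obtain ⟨t, ht⟩ := irrRep_isRegularFamily.exists_iso (ofChar_irred χ)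
    have hd := ht.degree_eq
    have hp : 1 < p := (Fact.out : p.Prime).one_lt
    rw [degree_ofChar, irrRep_degree] at hd
    cases t with
    | lin a b c =>
      refine ⟨(a, b, c), MonoidHom.ext fun g => Units.ext ?_⟩
      have := ht.char_eq g
      rw [char_ofChar] at this
      rw [this]
      exact (char_ofChar _ g).symm
    | mid => exact absurd hd hp.ne
    | midInf => exact absurd hd hp.ne
    | top => exact absurd hd (Nat.one_lt_pow two_ne_zero hp).ne

theorem fRep_tensor_fRep (a b c a' b' c' : ZMod p) :
    ((fRep a b c).tensor (fRep a' b' c')).Iso (fRep (a + a') (b + b') (c + c')) := by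
  refine irrRep_isRegularFamily.iso_of_char_eq fun g => ?_
  rw [char_tensor, char_fRep, char_fRep, char_fRep, ← zeta_add]
  congr 1
  ring

/-- An element acting trivially has character value p. This forces g₁₂ = g₂₃ = 0 and ζ^(-k g₁₃) = 1.
-/
theorem heisRep_eq_one_iff {k : ZMod p} (hk : k ≠ 0) (g : unitri 3 p) :
    (heisRep k).ρ g = 1 ↔ g = 1 := by
  refine ⟨fun h => ?_, fun h => by rw [h, map_one]⟩
  have hp := natCast_prime_ne_zero (p := p)
  have h1 : (heisRep k).char g = p := by
    have : (heisRep k).char g = (heisRep k).char 1 :=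
      congrArg (LinearMap.trace ℂ _) (h.trans (map_one (heisRep k).ρ).symm)
    rw [this, char_one, degree_heisRep]
  rw [char_heisRep hk] at h1
  split_ifs at h1 with h2
  · have h3 : zeta (-(k * ent g 0 2)) = 1 := mul_left_cancel₀ hp (h1.trans (mul_one _).symm)
    rw [← zeta_zero (p := p)] at h3
    have h4 := zeta_injective h3
    rw [neg_eq_zero, mul_eq_zero] at h4
    rw [← mk3_ent g, h2.1, h2.2, h4.resolve_left hk, mk3_zero]
  · exact absurd h1.symm hp

/-- As φ_i is faithful, the kernel of the inflation is the kernel of the retraction; x, y, z come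
from solving its equations, dividing by k, or by n if k = 0. -/
theorem phi_eq_one_iff (i : (ZMod p)ˣ) {n k : ZMod p} (h : (n, k) ≠ (0, 0)) (g : unitri 4 p) :
    (phi (i : ZMod p) (frac n k)).ρ g = 1 ↔
      ∃ x y z : ZMod p, g = mk4 (n * x) (n * y) z 0 (-(k * y)) (k * x) := by
  have h1 : ∀ a b c : ZMod p, mk3 a b c = 1 ↔ a = 0 ∧ b = 0 ∧ c = 0 := fun a b c => by
    refine ⟨fun e => ⟨?_, ?_, ?_⟩, fun e => by rw [e.1, e.2.1, e.2.2, mk3_zero]⟩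
    · have : a = ent (mk3 a b c) 0 1 := rfl
      rw [this, e, ent_one (by decide)]
    · have : b = ent (mk3 a b c) 1 2 := rfl
      rw [this, e, ent_one (by decide)]
    · have : c = ent (mk3 a b c) 0 2 := rfl
      rw [this, e, ent_one (by decide)]
  by_cases hk : k = 0
  · subst hk
    have hn : n ≠ 0 := fun hn => h (by rw [hn])
    have hf : frac n 0 = OnePoint.infty := if_pos rfl
    rw [hf]
    refine (heisRep_eq_one_iff i.ne_zero (retrZero 0 g)).trans ?_
    refine (h1 _ _ _).trans ?_
    simp only [zero_mul, sub_zero, add_zero, neg_zero]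
    constructor
    · rintro ⟨hv, hw, hy⟩
      refine ⟨ent g 0 1 / n, ent g 0 2 / n, ent g 0 3, ?_⟩
      conv_lhs => rw [← mk4_ent g, hv, hw, hy]
      rw [mul_div_cancel₀ _ hn, mul_div_cancel₀ _ hn]
    · rintro ⟨x, y, z, rfl⟩
      exact ⟨rfl, rfl, rfl⟩
  · have hf : frac n k = ↑(n / k) := if_neg hk
    rw [hf]
    refine (heisRep_eq_one_iff i.ne_zero (retrInf (n / k) g)).trans ?_
    refine (h1 _ _ _).trans ?_
    constructor
    · rintro ⟨hu, hv, hx⟩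
      refine ⟨ent g 2 3 / k, -(ent g 1 3 / k), ent g 0 3, ?_⟩
      rw [hv] at hx
      conv_lhs => rw [← mk4_ent g, hv]
      rw [mk4_inj]
      refine ⟨?_, ?_, rfl, rfl, ?_, ?_⟩
      · linear_combination hu
      · linear_combination hx
      · field_simp
      · field_simp
    · rintro ⟨x, y, z, rfl⟩
      refine ⟨?_, rfl, ?_⟩
      · change n * x - n / k * (k * x) = 0
        field_simp
        ring
      · change n * y + n / k * (-(k * y) - 0 * (k * x)) = 0
        field_simp
        ring

theorem CRep.pullback_pullback_iso {G K : Type} [Group G] [Group K] (A : CRep G) (θ : K →* G)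
    (η : G →* K) (h : ∀ g, θ (η g) = g) : ((A.pullback θ).pullback η).Iso A :=
  ⟨Representation.Equiv.mk (LinearEquiv.refl ℂ A.V) fun g => LinearMap.ext fun x => by
    change A.ρ (θ (η g)) x = A.ρ g x
    rw [h]⟩

theorem phiInf_pullback (i l : ZMod p) : ((phiInf i l).pullback inclInf).Iso (heisRep i) :=
  (heisRep i).pullback_pullback_iso _ _ fun g => by
    change mk3 (ent g 0 1 - l * 0) (ent g 1 2) (ent g 0 2 + l * (0 - ent g 1 2 * 0)) = g
    simp [mk3_ent]

theorem phiZero_pullback (i m : ZMod p) : ((phiZero i m).pullback inclZero).Iso (heisRep i) :=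
  (heisRep i).pullback_pullback_iso _ _ fun g => by
    change mk3 (ent g 0 1) (ent g 1 2 - m * 0) (ent g 0 2 + m * (0 - 0 * ent g 0 1)) = g
    simp [mk3_ent]

/-- The supports coincide, and i (g₁₃ + ℓ g₂₄) = iℓ (g₂₄ + ℓ⁻¹ g₁₃). -/
theorem phiInf_iso_phiZero (i : (ZMod p)ˣ) {l : ZMod p} (hl : l ≠ 0) :
    (phiInf (i : ZMod p) l).Iso (phiZero (i * l) l⁻¹) := by
  refine irrRep_isRegularFamily.iso_of_char_eq fun g => ?_
  rw [char_phiInf (zmodUnit_ne_zero i), char_phiZero (mul_ne_zero (zmodUnit_ne_zero i) hl)]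
  refine ite_congr (propext ?_) (fun _ => ?_) fun _ => rfl
  · rw [and_comm, eq_inv_mul_iff_mul_eq₀ hl, eq_comm (a := ent g 0 1)]
  · congr 2
    field_simp
    ring

/-- On the support of the character, g₁₂ = ℓ g₃₄ and g₂₃ = 0, so f_{(a,b,c)} agrees there with
f_{(0,0,aℓ+c)}. The two lemmas that follow use the same argument with their own supports. -/
theorem fRep_tensor_phi_coe (a b c : ZMod p) (i : (ZMod p)ˣ) (l : ZMod p) :
    ((fRep a b c).tensor (phi i l)).Iso (irrRep (.mid (a * l + c) i l)) := by
  refine irrRep_isRegularFamily.iso_of_char_eq fun g => ?_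
  simp only [irrRep, char_tensor, char_fRep, char_phi_coe (zmodUnit_ne_zero i)]
  split_ifs with h
  · rw [h.1, h.2]
    congr 2
    ring
  · simp

theorem fRep_tensor_phi_infty (a b c : ZMod p) (i : (ZMod p)ˣ) :
    ((fRep a b c).tensor (phi i OnePoint.infty)).Iso (irrRep (.midInf a i)) := by
  refine irrRep_isRegularFamily.iso_of_char_eq fun g => ?_
  simp only [irrRep, char_tensor, char_fRep, char_phi_infty (zmodUnit_ne_zero i)]
  split_ifs with h
  · rw [h.1, h.2]
    congr 2
    ring
  · simp

theorem fRep_tensor_psiRep (a b c : ZMod p) (k : (ZMod p)ˣ) :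
    ((fRep a b c).tensor (psiRep k)).Iso (irrRep (.top b k)) := by
  refine irrRep_isRegularFamily.iso_of_char_eq fun g => ?_
  simp only [irrRep, char_tensor, char_fRep, char_psiRep (zmodUnit_ne_zero k)]
  by_cases h : ent g 0 1 = 0 ∧ ent g 2 3 = 0
  · rw [h.1, h.2]
    congr 2
    ring
  · simp [h]

theorem fRep_zero_tensor (A : CRep (unitri 4 p)) : ((fRep 0 0 0).tensor A).Iso A := by
  refine irrRep_isRegularFamily.iso_of_char_eq fun g => ?_
  simp [char_tensor, char_fRep, zeta_zero]

theorem irrRep_injective : Function.Injective fun t : IrrIndex p => (irrRep t).cls :=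
  fun _ _ h => irrRep_isRegularFamily.eq_of_iso (irrRep_isRegularFamily.cls_eq_iff.1 h)

/-- Both sides are members of the list, where isomorphism means equality of indices. -/
theorem stabilizer_phi_coe (a b c : ZMod p) (i : (ZMod p)ˣ) (l : ZMod p) :
    ((fRep a b c).tensor (phi i l)).Iso (phi i l) ↔ a * l + c = 0 := by
  have h1 := fRep_tensor_phi_coe a b c i l
  have h2 : (irrRep (.mid 0 i l)).Iso (phi i l) := fRep_zero_tensor _
  refine ⟨fun h => ?_, fun h => ?_⟩
  · simpa using irrRep_isRegularFamily.eq_of_iso (h1.symm.trans (h.trans h2.symm))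
  · rw [h] at h1
    exact h1.trans h2

theorem stabilizer_phi_infty (a b c : ZMod p) (i : (ZMod p)ˣ) :
    ((fRep a b c).tensor (phi i OnePoint.infty)).Iso (phi i OnePoint.infty) ↔ a = 0 := by
  have h1 := fRep_tensor_phi_infty a b c i
  have h2 : (irrRep (.midInf 0 i)).Iso (phi i OnePoint.infty) := fRep_zero_tensor _
  refine ⟨fun h => ?_, fun h => ?_⟩
  · simpa using irrRep_isRegularFamily.eq_of_iso (h1.symm.trans (h.trans h2.symm))
  · rw [h] at h1 ⊢
    exact h1.trans h2

theorem stabilizer_psiRep (a b c : ZMod p) (k : (ZMod p)ˣ) :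
    ((fRep a b c).tensor (psiRep k)).Iso (psiRep k) ↔ b = 0 := by
  have h1 := fRep_tensor_psiRep a b c k
  have h2 : (irrRep (.top 0 k)).Iso (psiRep k) := fRep_zero_tensor _
  refine ⟨fun h => ?_, fun h => ?_⟩
  · simpa using irrRep_isRegularFamily.eq_of_iso (h1.symm.trans (h.trans h2.symm))
  · rw [h] at h1 ⊢
    exact h1.trans h2

theorem stabilizer_phi_frac (i : (ZMod p)ˣ) {n k : ZMod p} (h : (n, k) ≠ (0, 0))
    (a b c : ZMod p) :
    ((fRep a b c).tensor (phi (i : ZMod p) (frac n k))).Iso (phi (i : ZMod p) (frac n k)) ↔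
      ∃ x y : ZMod p, a = k * x ∧ b = y ∧ c = -(n * x) := by
  by_cases hk : k = 0
  · subst hk
    have hn : n ≠ 0 := fun hn => h (by rw [hn])
    have hf : frac n 0 = OnePoint.infty := if_pos rfl
    rw [hf, stabilizer_phi_infty]
    constructor
    · rintro rfl
      exact ⟨-(c / n), b, by simp, rfl, by field_simp⟩
    · rintro ⟨x, y, h1, -, -⟩
      simpa using h1
  · have hf : frac n k = ↑(n / k) := if_neg hk
    rw [hf, stabilizer_phi_coe]
    constructor
    · intro h1
      refine ⟨a / k, b, by field_simp, rfl, ?_⟩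
      linear_combination h1
    · rintro ⟨x, y, rfl, -, rfl⟩
      field_simp
      ring

/-- `r` tells which member `t d` of the list a twist of A is. As `r` takes every value and `t` is
injective, the orbit is in bijection with 𝔽_p. -/
theorem ncard_charOrbit {A : CRep (unitri 4 p)} (r : ZMod p → ZMod p → ZMod p → ZMod p)
    (hr : ∀ d, ∃ a b c, r a b c = d) (t : ZMod p → IrrIndex p) (ht : Function.Injective t)
    (h : ∀ a b c, ((fRep a b c).tensor A).Iso (irrRep (t (r a b c)))) :
    (charOrbit A).ncard = p := by
  have h1 : charOrbit A = Set.range fun d => (irrRep (t d)).cls := by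
    ext x
    constructor
    · rintro ⟨a, b, c, rfl⟩
      exact ⟨r a b c, (cls_iso (h a b c)).symm⟩
    · rintro ⟨d, rfl⟩
      obtain ⟨a, b, c, rfl⟩ := hr d
      exact ⟨a, b, c, (cls_iso (h a b c)).symm⟩
  rw [h1, ← Nat.card_coe_set_eq]
  exact (Nat.card_range_of_injective (irrRep_injective.comp ht)).trans (Nat.card_zmod p)

theorem ncard_charOrbit_phi (i : (ZMod p)ˣ) (l : OnePoint (ZMod p)) :
    (charOrbit (phi (i : ZMod p) l)).ncard = p := by
  induction l using OnePoint.rec with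
  | infty =>
    exact ncard_charOrbit (fun a _ _ => a) (fun d => ⟨d, 0, 0, rfl⟩) (.midInf · i)
      (fun _ _ h => by simpa using h) fun a b c => fRep_tensor_phi_infty a b c i
  | coe l =>
    exact ncard_charOrbit (fun a _ c => a * l + c) (fun d => ⟨0, 0, d, by simp⟩) (.mid · i l)
      (fun _ _ h => by simpa using h) fun a b c => fRep_tensor_phi_coe a b c i l

theorem ncard_charOrbit_psiRep (k : (ZMod p)ˣ) : (charOrbit (psiRep (k : ZMod p))).ncard = p :=
  ncard_charOrbit (fun _ b _ => b) (fun d => ⟨0, d, 0, rfl⟩) (.top · k)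
    (fun _ _ h => by simpa using h) fun a b c => fRep_tensor_psiRep a b c k

end AllPrimes

/-! ### Characters of exterior powers. -/

section ExteriorTrace

open Module

/-- X^m - 1 is separable over ℂ, so an operator of finite order is diagonalizable. -/
theorem exists_eigenbasis {V : Type*} [AddCommGroup V] [Module ℂ V] [Module.Finite ℂ V]
    {f : End ℂ V} {m : ℕ} (hm : m ≠ 0) (hf : f ^ m = 1) {d : ℕ} (hd : finrank ℂ V = d) :
    ∃ (b : Basis (Fin d) ℂ V) (μ : Fin d → ℂ), ∀ i, f (b i) = μ i • b i := by
  have hs : f.IsSemisimple := by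
    have hsep : (Polynomial.X ^ m - 1 : Polynomial ℂ).Separable :=
      Polynomial.separable_X_pow_sub_C 1 (by exact_mod_cast hm) one_ne_zero
    exact End.isSemisimple_of_squarefree_aeval_eq_zero hsep.squarefree (by simp [hf])
  have htop : ⨆ μ, f.eigenspace μ = ⊤ := by
    rw [← End.iSup_maxGenEigenspace_eq_top f]
    exact iSup_congr fun μ => (hs.isFinitelySemisimple.maxGenEigenspace_eq_eigenspace μ).symm
  have hint : DirectSum.IsInternal f.eigenspace :=
    DirectSum.isInternal_submodule_of_iSupIndep_of_iSup_eq_top f.eigenspaces_iSupIndep htop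
  let b' := hint.collectedBasis fun μ => finBasis ℂ (f.eigenspace μ)
  let e := b'.indexEquiv ((finBasis ℂ V).reindex (finCongr hd))
  refine ⟨b'.reindex e, fun i => (e.symm i).1, fun i => ?_⟩
  rw [Basis.reindex_apply]
  exact End.mem_eigenspace_iff.1 (hint.collectedBasis_mem _ (e.symm i))

theorem trace_eq_sum_of_eigenbasis {V ι : Type*} [AddCommGroup V] [Module ℂ V] [Fintype ι]
    [DecidableEq ι] (b : Basis ι ℂ V) {f : End ℂ V} {μ : ι → ℂ} (h : ∀ i, f (b i) = μ i • b i) :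
    LinearMap.trace ℂ V f = ∑ i, μ i := by
  rw [LinearMap.trace_eq_matrix_trace ℂ b]
  simp [Matrix.trace, LinearMap.toMatrix_apply, h]

/-- Wedges of distinct eigenvectors form an eigenbasis of the exterior power, so its trace is an
elementary symmetric function of the eigenvalues. -/
theorem trace_exteriorPower_map {V : Type*} [AddCommGroup V] [Module ℂ V] {d : ℕ}
    (b : Basis (Fin d) ℂ V) {f : End ℂ V} {μ : Fin d → ℂ} (h : ∀ i, f (b i) = μ i • b i)
    (n : ℕ) : LinearMap.trace ℂ (⋀[ℂ]^n V) (exteriorPower.map n f) =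
      ∑ s ∈ Finset.univ.powersetCard n, ∏ i ∈ s, μ i := by
  classical
  have : Fintype (Set.powersetCard (Fin d) n) := Fintype.ofFinite _
  rw [trace_eq_sum_of_eigenbasis (b.exteriorPower n) (μ := fun s => ∏ i ∈ s.val, μ i)]
  · exact (Finset.sum_subtype _ (p := fun s => s ∈ Set.powersetCard (Fin d) n)
      (fun s => by simp [Set.powersetCard.mem_iff]) fun s => ∏ i ∈ s, μ i).symm
  · intro s
    rw [exteriorPower.basis_apply, exteriorPower.map_apply_ιMulti_family,
      exteriorPower.ιMulti_family, exteriorPower.ιMulti_family]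
    have h1 : (f ∘ b) ∘ (Set.powersetCard.ofFinEmbEquiv.symm s) = fun k =>
        μ (Set.powersetCard.ofFinEmbEquiv.symm s k) •
          (b ∘ (Set.powersetCard.ofFinEmbEquiv.symm s)) k := funext fun k => h _
    rw [h1]
    refine ((exteriorPower.ιMulti ℂ n).toMultilinearMap.map_smul_univ _ _).trans ?_
    congr 1
    have hc : s.val.card = n := s.prop
    -- The scalars pulled out of the wedge are indexed by positions; the increasing enumeration of s
    -- turns their product into the product over s.
    have h2 : s.val = Finset.univ.map (s.val.orderEmbOfFin hc).toEmbedding :=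
      (Finset.map_orderEmbOfFin_univ _ hc).symm
    conv_rhs => rw [h2, Finset.prod_map]
    rfl

open CRep

/-- One eigenbasis of g serves all powers of g, so characters give power sums and exterior powers
give elementary symmetric functions of the same μ. Newton's identities, cleared of denominators,
yield the formulas that follow. -/
theorem CRep.exists_eigenvalues {G : Type} [Group G] [Finite G] (A : CRep G) {d : ℕ}
    (hd : A.degree = d) (g : G) : ∃ μ : Fin d → ℂ, (∀ k : ℕ, A.char (g ^ k) = ∑ i, μ i ^ k) ∧
      ∀ n, (A.extPow n).char g = ∑ s ∈ Finset.univ.powersetCard n, ∏ i ∈ s, μ i := by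
  obtain ⟨b, μ, h⟩ := exists_eigenbasis (f := A.ρ g) (orderOf_pos g).ne'
    (by rw [← map_pow, pow_orderOf_eq_one, map_one]) hd
  refine ⟨μ, fun k => ?_, fun n => trace_exteriorPower_map b h n⟩
  refine trace_eq_sum_of_eigenbasis b (f := A.ρ (g ^ k)) fun i => ?_
  rw [map_pow]
  induction k with
  | zero => simp
  | succ k ih => rw [pow_succ, Module.End.mul_apply, h, map_smul, ih, smul_smul, pow_succ, mul_comm]

theorem CRep.char_extPow_two_of_degree_two {G : Type} [Group G] [Finite G] {A : CRep G}
    (hd : A.degree = 2) (g : G) :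
    2 * (A.extPow 2).char g = A.char g ^ 2 - A.char (g ^ 2) := by
  obtain ⟨μ, h1, h2⟩ := A.exists_eigenvalues hd g
  have h := h1 1
  have hs : (Finset.univ : Finset (Fin 2)).powersetCard 2 = {{0, 1}} := by decide
  rw [pow_one] at h
  rw [h, h1, h2, hs]
  simp [Fin.sum_univ_succ]
  ring

theorem CRep.char_extPow_two {G : Type} [Group G] [Finite G] {A : CRep G}
    (hd : A.degree = 4) (g : G) :
    2 * (A.extPow 2).char g = A.char g ^ 2 - A.char (g ^ 2) := by
  obtain ⟨μ, h1, h2⟩ := A.exists_eigenvalues hd g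
  have h := h1 1
  have hs : (Finset.univ : Finset (Fin 4)).powersetCard 2 =
    {{0, 1}, {0, 2}, {0, 3}, {1, 2}, {1, 3}, {2, 3}} := by decide
  rw [pow_one] at h
  rw [h, h1, h2, hs]
  repeat rw [Finset.sum_insert (by decide)]
  simp [Fin.sum_univ_succ]
  ring

theorem CRep.char_extPow_three {G : Type} [Group G] [Finite G] {A : CRep G}
    (hd : A.degree = 4) (g : G) : 6 * (A.extPow 3).char g =
      A.char g ^ 3 - 3 * A.char g * A.char (g ^ 2) + 2 * A.char (g ^ 3) := by
  obtain ⟨μ, h1, h2⟩ := A.exists_eigenvalues hd g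
  have h := h1 1
  have hs : (Finset.univ : Finset (Fin 4)).powersetCard 3 =
    {{0, 1, 2}, {0, 1, 3}, {0, 2, 3}, {1, 2, 3}} := by decide
  rw [pow_one] at h
  rw [h, h1, h1, h2, hs]
  repeat rw [Finset.sum_insert (by decide)]
  simp [Fin.sum_univ_succ]
  ring

theorem CRep.char_extPow_four {G : Type} [Group G] [Finite G] {A : CRep G}
    (hd : A.degree = 4) (g : G) : 24 * (A.extPow 4).char g =
      A.char g ^ 4 - 6 * A.char g ^ 2 * A.char (g ^ 2) + 3 * A.char (g ^ 2) ^ 2 +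
        8 * A.char g * A.char (g ^ 3) - 6 * A.char (g ^ 4) := by
  obtain ⟨μ, h1, h2⟩ := A.exists_eigenvalues hd g
  have h := h1 1
  have hs : (Finset.univ : Finset (Fin 4)).powersetCard 4 = {{0, 1, 2, 3}} := by decide
  rw [pow_one] at h
  rw [h, h1, h1, h1, h2, hs]
  simp [Fin.sum_univ_succ]
  ring

end ExteriorTrace

/-! ### Integer-valued character table for p = 2. -/

section CharacterTable

open CRep

/-- The nontrivial character of `𝔽₂`, with integer values. -/
def sgn2 (x : ZMod 2) : ℤ := if x = 0 then 1 else -1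

theorem zmod_two_cases : ∀ x : ZMod 2, x = 0 ∨ x = 1 := by decide

theorem zeta_two (x : ZMod 2) : zeta x = (sgn2 x : ℂ) := by
  have h0 : zeta (0 : ZMod 2) = 1 := zeta_zero
  have h1 : zeta (1 : ZMod 2) * zeta (1 : ZMod 2) = 1 := by
    rw [← zeta_add, ← h0]
    rfl
  have h2 : zeta (1 : ZMod 2) = -1 := (mul_self_eq_one_iff.1 h1).resolve_left fun h =>
    one_ne_zero (zeta_injective (h.trans h0.symm))
  have h3 : sgn2 0 = 1 := rfl
  have h4 : sgn2 1 = -1 := rfl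
  rcases zmod_two_cases x with rfl | rfl
  · rw [h0, h3, Int.cast_one]
  · rw [h2, h4, Int.cast_neg, Int.cast_one]

/-- Integer values of the character of `f_{(a,b,c)}`. -/
def chiF (a b c u v w : ZMod 2) : ℤ := sgn2 (a * u + b * v + c * w)

/-- Integer values of the character of `φ_ℓ`, `ℓ ≠ ∞`. -/
def chiPhi (l u x v y w : ZMod 2) : ℤ := if u = l * w ∧ v = 0 then 2 * sgn2 (x + l * y) else 0

/-- Integer values of the character of `φ_∞`. -/
def chiInf (v y w : ZMod 2) : ℤ := if v = 0 ∧ w = 0 then 2 * sgn2 y else 0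

/-- Integer values of the character of `ψ`. -/
def chiPsi (u x z v y w : ZMod 2) : ℤ :=
  if u = 0 ∧ w = 0 then
    if v = 0 then if x = 0 ∧ y = 0 then 4 * sgn2 z else 0 else 2 * sgn2 (x * y + z)
  else 0

variable (u x z v y w : ZMod 2)

theorem char_fRep_two (a b c : ZMod 2) :
    (fRep a b c).char (mk4 u x z v y w) = (chiF a b c u v w : ℂ) :=
  (char_fRep a b c _).trans (zeta_two _)

theorem char_phi2_coe (l : ZMod 2) :
    (phi2 l).char (mk4 u x z v y w) = (chiPhi l u x v y w : ℂ) := by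
  refine (char_phi_coe one_ne_zero l _).trans ?_
  change (if u = l * w ∧ v = 0 then ((2 : ℕ) : ℂ) * zeta (-(1 * (x + l * y))) else 0) = _
  rw [zeta_two, one_mul, ZMod.neg_eq_self_mod_two]
  unfold chiPhi
  split_ifs <;> push_cast <;> rfl

theorem char_phi2_infty :
    (phi2 OnePoint.infty).char (mk4 u x z v y w) = (chiInf v y w : ℂ) := by
  refine (char_phi_infty one_ne_zero _).trans ?_
  change (if v = 0 ∧ w = 0 then ((2 : ℕ) : ℂ) * zeta (-(1 * y)) else 0) = _
  rw [zeta_two, one_mul, ZMod.neg_eq_self_mod_two]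
  unfold chiInf
  split_ifs <;> push_cast <;> rfl

theorem char_psi2 : psi2.char (mk4 u x z v y w) = (chiPsi u x z v y w : ℂ) := by
  refine (char_psiRep one_ne_zero _).trans ?_
  change (if u = 0 ∧ w = 0 then if v = 0 then if x = 0 ∧ y = 0 then
    ((2 : ℕ) : ℂ) ^ 2 * zeta (-(1 * z)) else 0 else
    ((2 : ℕ) : ℂ) * zeta (1 * (x * y / v - z)) else 0) = _
  rw [zeta_two, zeta_two, one_mul, one_mul, ZMod.neg_eq_self_mod_two]
  -- In 𝔽₂ a nonzero v is 1 and signs disappear, so the division drops out of the formula.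
  have h : v ≠ 0 → x * y / v - z = x * y + z := fun hv => by
    rw [(zmod_two_cases v).resolve_left hv, div_one, sub_eq_add_neg, ZMod.neg_eq_self_mod_two]
  unfold chiPsi
  split_ifs with h1 h2 h3
  · push_cast
    norm_num
  · simp
  · rw [h h2]
    push_cast
    rfl
  · simp

/-- Reduces an identity in R(G) to its values at all choices of six bits; with integer character
values these are settled by `decide`. -/
theorem RepRing.ext_two {a b : RepRing (unitri 4 2)}
    (h : ∀ u x z v y w : ZMod 2, charHom (mk4 u x z v y w) a = charHom (mk4 u x z v y w) b) :
    a = b :=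
  irrRep_isRegularFamily.ext fun g => by rw [← mk4_ent g]; exact h _ _ _ _ _ _

end CharacterTable

/-! ### The multiplicative relations for p = 2. -/

section Relations

open CRep

theorem stabilizer_phi2_coe (a b c l : ZMod 2) :
    ((fRep a b c).tensor (phi2 l)).Iso (phi2 l) ↔ a * l + c = 0 := stabilizer_phi_coe a b c 1 l

theorem stabilizer_phi2_infty (a b c : ZMod 2) :
    ((fRep a b c).tensor (phi2 OnePoint.infty)).Iso (phi2 OnePoint.infty) ↔ a = 0 :=
  stabilizer_phi_infty a b c 1

theorem cls_fRep_mul (a b c a' b' c' : ZMod 2) :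
    (fRep a b c).cls * (fRep a' b' c').cls = (fRep (a + a') (b + b') (c + c')).cls := by
  rw [← cls_tensor]
  exact cls_iso (fRep_tensor_fRep _ _ _ _ _ _)

theorem cls_fRep_mul_phi2 (n k x y : ZMod 2) (h : (n, k) ≠ (0, 0)) :
    (fRep (k * x) y (n * x)).cls * (phi2 (frac n k)).cls = (phi2 (frac n k)).cls := by
  rw [← cls_tensor]
  refine cls_iso ((stabilizer_phi_frac 1 h _ _ _).2 ⟨x, y, rfl, rfl, ?_⟩)
  rw [ZMod.neg_eq_self_mod_two]

theorem cls_fRep_mul_psi2 (x y : ZMod 2) : (fRep x 0 y).cls * psi2.cls = psi2.cls := by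
  rw [← cls_tensor]
  exact cls_iso ((stabilizer_psiRep x 0 y 1).2 rfl)

theorem cls_phi2_sq (n k : ZMod 2) (h : (n, k) ≠ (0, 0)) : (phi2 (frac n k)).cls ^ 2 =
    ∑ a : ZMod 2, ∑ b : ZMod 2, (fRep (k * a) b (-(n * a))).cls := by
  refine RepRing.ext_two fun u x z v y w => ?_
  simp only [map_pow, map_sum, charHom_cls, char_fRep_two]
  rcases zmod_two_cases k with rfl | rfl
  · have hn : n = 1 := (zmod_two_cases n).resolve_left fun hn => h (by rw [hn])
    have hf : frac n 0 = OnePoint.infty := if_pos rfl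
    rw [hf, char_phi2_infty, hn]
    norm_cast
    revert u v y w
    decide
  · have hf : frac n 1 = ↑n := (if_neg one_ne_zero).trans (by rw [div_one])
    rw [hf, char_phi2_coe]
    norm_cast
    clear h hf
    revert n u x v y w
    decide

/-- Here and in the next lemma, the nonvanishing condition is the decidable form of "f does not fix
the third φ", by `stabilizer_phi2_infty` and `stabilizer_phi2_coe`. -/
theorem cls_phi2_coe_mul_coe {l₁ l₂ a : ZMod 2} (b c : ZMod 2) (h : l₁ ≠ l₂) (ha : a ≠ 0) :
    (phi2 l₁).cls * (phi2 l₂).cls =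
      (phi2 OnePoint.infty).cls + (fRep a b c).cls * (phi2 OnePoint.infty).cls := by
  refine RepRing.ext_two fun u x z v y w => ?_
  simp only [map_add, map_mul, charHom_cls, char_fRep_two, char_phi2_coe, char_phi2_infty]
  norm_cast
  revert h ha
  revert l₁ l₂ a b c u x z v y w
  decide

theorem cls_phi2_coe_mul_infty {l₁ l₂ a c : ZMod 2} (b : ZMod 2) (h : l₁ ≠ l₂)
    (ha : a * l₂ + c ≠ 0) : (phi2 l₁).cls * (phi2 OnePoint.infty).cls =
      (phi2 l₂).cls + (fRep a b c).cls * (phi2 l₂).cls := by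
  refine RepRing.ext_two fun u x z v y w => ?_
  simp only [map_add, map_mul, charHom_cls, char_fRep_two, char_phi2_coe, char_phi2_infty]
  norm_cast
  revert h ha
  revert l₁ l₂ a b c u x z v y w
  decide

theorem cls_phi2_mul (l₁ l₂ l₃ : OnePoint (ZMod 2)) (a b c : ZMod 2) (h₁₂ : l₁ ≠ l₂)
    (h₁₃ : l₁ ≠ l₃) (h₂₃ : l₂ ≠ l₃) (h : ¬ ((fRep a b c).tensor (phi2 l₃)).Iso (phi2 l₃)) :
    (phi2 l₁).cls * (phi2 l₂).cls = (phi2 l₃).cls + (fRep a b c).cls * (phi2 l₃).cls := by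
  induction l₃ using OnePoint.rec with
  | infty =>
    rw [stabilizer_phi2_infty] at h
    obtain ⟨m₁, rfl⟩ := OnePoint.ne_infty_iff_exists.1 h₁₃
    obtain ⟨m₂, rfl⟩ := OnePoint.ne_infty_iff_exists.1 h₂₃
    exact cls_phi2_coe_mul_coe b c (fun e => h₁₂ (by rw [e])) h
  | coe l₃ =>
    rw [stabilizer_phi2_coe] at h
    induction l₁ using OnePoint.rec with
    | infty =>
      obtain ⟨m₂, rfl⟩ := OnePoint.ne_infty_iff_exists.1 h₁₂.symm
      rw [mul_comm]
      exact cls_phi2_coe_mul_infty b (fun e => h₂₃ (by rw [e])) h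
    | coe l₁ =>
      induction l₂ using OnePoint.rec with
      | infty => exact cls_phi2_coe_mul_infty b (fun e => h₁₃ (by rw [e])) h
      | coe l₂ =>
        have h1 : l₁ ≠ l₂ := fun e => h₁₂ (by rw [e])
        have h2 : l₁ ≠ l₃ := fun e => h₁₃ (by rw [e])
        have h3 : l₂ ≠ l₃ := fun e => h₂₃ (by rw [e])
        -- 𝔽₂ does not contain three distinct elements.
        exfalso
        clear h h₁₂ h₁₃ h₂₃
        revert l₁ l₂ l₃
        decide

theorem cls_psi2_sq : psi2.cls ^ 2 =
    (∑ a : ZMod 2, ∑ b : ZMod 2, (fRep a 0 b).cls) +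
      (∑ a : ZMod 2, ∑ l : ZMod 2, (fRep 0 0 a).cls * (phi2 l).cls) +
      ∑ a : ZMod 2, (fRep a 0 0).cls * (phi2 OnePoint.infty).cls := by
  refine RepRing.ext_two fun u x z v y w => ?_
  simp only [map_add, map_mul, map_pow, map_sum, charHom_cls, char_fRep_two, char_phi2_coe,
    char_phi2_infty, char_psi2]
  norm_cast
  revert u x z v y w
  decide

theorem cls_phi2_mul_psi2 (l : OnePoint (ZMod 2)) :
    (phi2 l).cls * psi2.cls = psi2.cls + (fRep 0 1 0).cls * psi2.cls := by
  refine RepRing.ext_two fun u x z v y w => ?_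
  induction l using OnePoint.rec with
  | infty =>
    simp only [map_add, map_mul, charHom_cls, char_fRep_two, char_phi2_infty, char_psi2]
    norm_cast
    revert u x z v y w
    decide
  | coe l =>
    simp only [map_add, map_mul, charHom_cls, char_fRep_two, char_phi2_coe, char_psi2]
    norm_cast
    revert l u x z v y w
    decide

end Relations

/-! ### The exterior powers for p = 2. -/

section ExteriorPowers

open CRep

theorem degree_phi2 (l : OnePoint (ZMod 2)) : (phi2 l).degree = 2 := degree_phi _ _

theorem degree_psi2 : psi2.degree = 4 := degree_psiRep _

theorem mk4_two_sq (u x z v y w : ZMod 2) :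
    (mk4 u x z v y w) ^ 2 = mk4 0 (u * v) (u * y + x * w) 0 (v * w) 0 := by
  rw [sq, mk4_mul, mk4_inj]
  revert u x z v y w
  decide

theorem phi2_coe_extPow_two (l : ZMod 2) : ((phi2 l).extPow 2).cls = (fRep 1 1 l).cls := by
  refine RepRing.ext_two fun u x z v y w => ?_
  rw [charHom_cls, charHom_cls, char_fRep_two]
  refine mul_left_cancel₀ (two_ne_zero (α := ℂ)) ?_
  rw [char_extPow_two_of_degree_two (degree_phi2 _), mk4_two_sq, char_phi2_coe, char_phi2_coe]
  norm_cast
  revert l u x z v y w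
  decide

theorem phi2_infty_extPow_two :
    ((phi2 OnePoint.infty).extPow 2).cls = (fRep 0 1 1).cls := by
  refine RepRing.ext_two fun u x z v y w => ?_
  rw [charHom_cls, charHom_cls, char_fRep_two]
  refine mul_left_cancel₀ (two_ne_zero (α := ℂ)) ?_
  rw [char_extPow_two_of_degree_two (degree_phi2 _), mk4_two_sq, char_phi2_infty, char_phi2_infty]
  norm_cast
  revert u x z v y w
  decide

theorem psi2_extPow_two : (psi2.extPow 2).cls =
    (fRep 0 0 1).cls * (phi2 (0 : ZMod 2)).cls + (fRep 0 0 1).cls * (phi2 (1 : ZMod 2)).cls +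
      (fRep 1 0 0).cls * (phi2 OnePoint.infty).cls := by
  refine RepRing.ext_two fun u x z v y w => ?_
  refine mul_left_cancel₀ (two_ne_zero (α := ℂ)) ?_
  rw [charHom_cls, char_extPow_two degree_psi2, mk4_two_sq]
  simp only [map_add, map_mul, charHom_cls, char_fRep_two, char_phi2_coe, char_phi2_infty,
    char_psi2]
  norm_cast
  revert u x z v y w
  decide

theorem mk4_two_cube (u x z v y w : ZMod 2) : (mk4 u x z v y w) ^ 3 =
    mk4 u (x + u * v) (z + u * v * w + u * y + x * w) v (y + v * w) w := by
  rw [pow_succ, mk4_two_sq, mk4_mul, mk4_inj]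
  revert u x z v y w
  decide

/-- The identity is kept in coordinates so that the character formula `char_psi2` applies to it. -/
theorem mk4_two_pow_four (u x z v y w : ZMod 2) : (mk4 u x z v y w) ^ 4 = mk4 0 0 0 0 0 0 := by
  rw [pow_succ, mk4_two_cube, mk4_mul, mk4_inj]
  revert u x z v y w
  decide

theorem psi2_extPow_three : (psi2.extPow 3).cls = (fRep 0 1 0).cls * psi2.cls := by
  refine RepRing.ext_two fun u x z v y w => ?_
  refine mul_left_cancel₀ (by norm_num : (6 : ℂ) ≠ 0) ?_
  rw [charHom_cls, char_extPow_three degree_psi2, mk4_two_sq, mk4_two_cube]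
  simp only [map_mul, charHom_cls, char_fRep_two, char_psi2]
  norm_cast
  revert u x z v y w
  decide

theorem psi2_extPow_four : (psi2.extPow 4).cls = (fRep 0 1 0).cls := by
  refine RepRing.ext_two fun u x z v y w => ?_
  refine mul_left_cancel₀ (by norm_num : (24 : ℂ) ≠ 0) ?_
  rw [charHom_cls, char_extPow_four degree_psi2, mk4_two_sq, mk4_two_cube, mk4_two_pow_four]
  simp only [charHom_cls, char_fRep_two, char_psi2]
  norm_cast
  revert u x z v y w
  decide

end ExteriorPowers

/-! ### Generators and relations of R(G) for p = 2. -/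

section Presentation

open CRep

theorem cls_fRep_zero : (fRep (0 : ZMod 2) 0 0).cls = 1 := by
  rw [← cls_triv]
  refine cls_iso (irrRep_isRegularFamily.iso_of_char_eq fun g => ?_)
  rw [char_fRep, char_triv]
  simp [zeta_zero]

theorem aeval_polyF (a b c : ZMod 2) :
    MvPolynomial.aeval Gen2.val (polyF a b c) = (fRep a b c).cls := by
  have h0 : (0 : ZMod 2).val = 0 := rfl
  have h1 : (1 : ZMod 2).val = 1 := rfl
  have ha : (fRep 1 0 0).cls ^ a.val = (fRep a 0 0).cls := by
    rcases zmod_two_cases a with rfl | rfl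
    · rw [h0, pow_zero, cls_fRep_zero]
    · rw [h1, pow_one]
  have hb : (fRep 0 1 0).cls ^ b.val = (fRep 0 b 0).cls := by
    rcases zmod_two_cases b with rfl | rfl
    · rw [h0, pow_zero, cls_fRep_zero]
    · rw [h1, pow_one]
  have hc : (fRep 0 0 1).cls ^ c.val = (fRep 0 0 c).cls := by
    rcases zmod_two_cases c with rfl | rfl
    · rw [h0, pow_zero, cls_fRep_zero]
    · rw [h1, pow_one]
  simp only [polyF, map_mul, map_pow, MvPolynomial.aeval_X, Gen2.val, ha, hb, hc, cls_fRep_mul,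
    add_zero, zero_add]

theorem aeval_polyPhi (l : OnePoint (ZMod 2)) :
    MvPolynomial.aeval Gen2.val (polyPhi l) = (phi2 l).cls := MvPolynomial.aeval_X _ _

theorem aeval_polyPsi : MvPolynomial.aeval Gen2.val polyPsi = psi2.cls := MvPolynomial.aeval_X _ _

theorem aeval_mulRel2 {q : MvPolynomial Gen2 ℤ} (h : MulRel2 q) :
    MvPolynomial.aeval Gen2.val q = 0 := by
  cases h with
  | f_mul a b c a' b' c' =>
    rw [map_sub, map_mul, aeval_polyF, aeval_polyF, aeval_polyF, cls_fRep_mul, sub_self]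
  | f_phi n k x y h =>
    rw [map_sub, map_mul, aeval_polyF, aeval_polyPhi, cls_fRep_mul_phi2 _ _ _ _ h, sub_self]
  | f_psi x y => rw [map_sub, map_mul, aeval_polyF, aeval_polyPsi, cls_fRep_mul_psi2, sub_self]
  | phi_sq n k h =>
    simp only [map_sub, map_pow, map_sum, aeval_polyF, aeval_polyPhi]
    rw [cls_phi2_sq _ _ h, sub_self]
  | phi_mul l₁ l₂ l₃ a b c h₁ h₂ h₃ h =>
    simp only [map_sub, map_add, map_mul, aeval_polyF, aeval_polyPhi]
    rw [cls_phi2_mul l₁ l₂ l₃ a b c h₁ h₂ h₃ h, sub_self]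
  | psi_sq =>
    simp only [map_sub, map_add, map_mul, map_pow, map_sum, aeval_polyF, aeval_polyPhi,
      aeval_polyPsi]
    rw [cls_psi2_sq, sub_self]
  | phi_psi l =>
    simp only [map_sub, map_add, map_mul, aeval_polyF, aeval_polyPhi, aeval_polyPsi]
    rw [cls_phi2_mul_psi2, sub_self]

/-- The ideal of relations between the generators. -/
noncomputable def relIdeal : Ideal (MvPolynomial Gen2 ℤ) := Ideal.span {q | MulRel2 q}

/-- The polynomial in the generators that represents an irreducible representation. -/
noncomputable def irrPoly : IrrIndex 2 → MvPolynomial Gen2 ℤ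
  | .lin a b c => polyF a b c
  | .mid a _ l => polyF 0 0 a * polyPhi l
  | .midInf a _ => polyF a 0 0 * polyPhi OnePoint.infty
  | .top a _ => polyF 0 a 0 * polyPsi

theorem zmodTwo_units (i : (ZMod 2)ˣ) : (i : ZMod 2) = 1 :=
  (zmod_two_cases i).resolve_left i.ne_zero

theorem aeval_irrPoly (t : IrrIndex 2) :
    MvPolynomial.aeval Gen2.val (irrPoly t) = (irrRep t).cls := by
  cases t with
  | lin a b c => exact aeval_polyF a b c
  | mid a i l =>
    rw [irrPoly, map_mul, aeval_polyF, aeval_polyPhi, irrRep, zmodTwo_units i, cls_tensor, phi2]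
  | midInf a i =>
    rw [irrPoly, map_mul, aeval_polyF, aeval_polyPhi, irrRep, zmodTwo_units i, cls_tensor, phi2]
  | top a i =>
    rw [irrPoly, map_mul, aeval_polyF, aeval_polyPsi, irrRep, zmodTwo_units i, cls_tensor, psi2]

/-- The quotient map modulo the relations. -/
noncomputable abbrev modRel : MvPolynomial Gen2 ℤ →+* MvPolynomial Gen2 ℤ ⧸ relIdeal :=
  Ideal.Quotient.mk relIdeal

theorem mk_eq_of_mulRel2 {q r : MvPolynomial Gen2 ℤ} (h : MulRel2 (q - r)) : modRel q = modRel r :=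
  Ideal.Quotient.eq.2 (Ideal.subset_span h)

theorem mk_polyF_mul (a b c a' b' c' : ZMod 2) :
    modRel (polyF a b c) * modRel (polyF a' b' c') = modRel (polyF (a + a') (b + b') (c + c')) := by
  rw [← map_mul]
  exact mk_eq_of_mulRel2 (.f_mul ..)

/-- The relation `f_phi` lets φ_ℓ absorb f_{(a,b,ℓa)}. In characteristic 2, what is left of
f_{(a,b,c)} is f_{(0,0,aℓ+c)}. -/
theorem mk_polyF_mul_polyPhi_coe (a b c l : ZMod 2) :
    modRel (polyF a b c) * modRel (polyPhi l) = modRel (irrPoly (.mid (a * l + c) 1 l)) := by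
  have h1 : modRel (polyF a b (l * a)) * modRel (polyPhi l) = modRel (polyPhi l) := by
    have h := mk_eq_of_mulRel2 (.f_phi l 1 a b (by simp))
    have hf : frac l 1 = (l : OnePoint (ZMod 2)) := (if_neg one_ne_zero).trans (by rw [div_one])
    rwa [map_mul, hf, one_mul] at h
  have h2 : c = a * l + c + l * a := by
    clear h1
    revert a c l
    decide
  rw [irrPoly, map_mul]
  conv_rhs => rw [← h1, ← mul_assoc, mk_polyF_mul, zero_add, zero_add, ← h2]

theorem mk_polyF_mul_polyPhi_infty (a b c : ZMod 2) :
    modRel (polyF a b c) * modRel (polyPhi OnePoint.infty) = modRel (irrPoly (.midInf a 1)) := by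
  have h1 : modRel (polyF 0 b c) * modRel (polyPhi OnePoint.infty) =
      modRel (polyPhi OnePoint.infty) := by
    have h := mk_eq_of_mulRel2 (.f_phi 1 0 c b (by simp))
    have hf : frac 1 0 = (OnePoint.infty : OnePoint (ZMod 2)) := if_pos rfl
    rwa [map_mul, hf, one_mul, zero_mul] at h
  rw [irrPoly, map_mul]
  conv_rhs => rw [← h1, ← mul_assoc, mk_polyF_mul, zero_add, zero_add, add_zero]

theorem mk_polyF_mul_polyPsi (a b c : ZMod 2) :
    modRel (polyF a b c) * modRel polyPsi = modRel (irrPoly (.top b 1)) := by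
  have h1 : modRel (polyF a 0 c) * modRel polyPsi = modRel polyPsi := by
    rw [← map_mul]
    exact mk_eq_of_mulRel2 (.f_psi ..)
  rw [irrPoly, map_mul]
  conv_rhs => rw [← h1, ← mul_assoc, mk_polyF_mul, zero_add, zero_add, add_zero]

theorem mk_polyF_zero : modRel (polyF 0 0 0) = 1 := by
  have h0 : (0 : ZMod 2).val = 0 := rfl
  simp [polyF, h0]

/-- The additive span of the representatives of the irreducible representations. -/
noncomputable def irrSpan : Submodule ℤ (MvPolynomial Gen2 ℤ ⧸ relIdeal) :=
  Submodule.span ℤ (Set.range fun t => modRel (irrPoly t))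

theorem mk_irrPoly_mem (t : IrrIndex 2) : modRel (irrPoly t) ∈ irrSpan :=
  Submodule.subset_span ⟨t, rfl⟩

theorem mk_polyF_mem (a b c : ZMod 2) : modRel (polyF a b c) ∈ irrSpan :=
  mk_irrPoly_mem (.lin a b c)

theorem mk_polyF_mul_polyPhi_mem (a b c : ZMod 2) (l : OnePoint (ZMod 2)) :
    modRel (polyF a b c) * modRel (polyPhi l) ∈ irrSpan := by
  induction l using OnePoint.rec with
  | infty => rw [mk_polyF_mul_polyPhi_infty]; exact mk_irrPoly_mem _
  | coe l => rw [mk_polyF_mul_polyPhi_coe]; exact mk_irrPoly_mem _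

theorem mk_polyF_mul_polyPsi_mem (a b c : ZMod 2) :
    modRel (polyF a b c) * modRel polyPsi ∈ irrSpan := by
  rw [mk_polyF_mul_polyPsi]
  exact mk_irrPoly_mem _

theorem mk_polyPhi_mem (l : OnePoint (ZMod 2)) : modRel (polyPhi l) ∈ irrSpan := by
  rw [← one_mul (modRel (polyPhi l)), ← mk_polyF_zero]
  exact mk_polyF_mul_polyPhi_mem _ _ _ _

theorem mk_polyPsi_mem : modRel polyPsi ∈ irrSpan := by
  rw [← one_mul (modRel polyPsi), ← mk_polyF_zero]
  exact mk_polyF_mul_polyPsi_mem _ _ _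

/-- The three shapes f, fφ and fψ cover all four families of spanning elements. -/
theorem mul_mem_irrSpan {x : MvPolynomial Gen2 ℤ ⧸ relIdeal}
    (hF : ∀ a b c, x * modRel (polyF a b c) ∈ irrSpan)
    (hPhi : ∀ a b c l, x * (modRel (polyF a b c) * modRel (polyPhi l)) ∈ irrSpan)
    (hPsi : ∀ a b c, x * (modRel (polyF a b c) * modRel polyPsi) ∈ irrSpan)
    {y : MvPolynomial Gen2 ℤ ⧸ relIdeal} (hy : y ∈ irrSpan) : x * y ∈ irrSpan := by
  induction hy using Submodule.span_induction with
  | mem y hy =>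
    obtain ⟨t, rfl⟩ := hy
    cases t with
    | lin a b c => exact hF a b c
    | mid a i l => simpa only [irrPoly, map_mul] using hPhi 0 0 a l
    | midInf a i => simpa only [irrPoly, map_mul] using hPhi a 0 0 OnePoint.infty
    | top a i => simpa only [irrPoly, map_mul] using hPsi 0 a 0
  | zero => rw [mul_zero]; exact Submodule.zero_mem _
  | add y z _ _ hy hz => rw [mul_add]; exact Submodule.add_mem _ hy hz
  | smul a y _ hy => rw [mul_smul_comm]; exact Submodule.smul_mem _ _ hy

theorem mk_polyF_mul_mem (a b c : ZMod 2) {y : MvPolynomial Gen2 ℤ ⧸ relIdeal}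
    (hy : y ∈ irrSpan) : modRel (polyF a b c) * y ∈ irrSpan :=
  mul_mem_irrSpan (fun _ _ _ => by rw [mk_polyF_mul]; exact mk_polyF_mem _ _ _)
    (fun _ _ _ _ => by
      rw [← mul_assoc, mk_polyF_mul]; exact mk_polyF_mul_polyPhi_mem _ _ _ _)
    (fun _ _ _ => by rw [← mul_assoc, mk_polyF_mul]; exact mk_polyF_mul_polyPsi_mem _ _ _) hy

theorem exists_not_stabilizer (l : OnePoint (ZMod 2)) :
    ∃ a b c : ZMod 2, ¬ ((fRep a b c).tensor (phi2 l)).Iso (phi2 l) := by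
  induction l using OnePoint.rec with
  | infty => exact ⟨1, 0, 0, by rw [stabilizer_phi2_infty]; decide⟩
  | coe l => exact ⟨0, 0, 1, by rw [stabilizer_phi2_coe]; simp⟩

/-- Provides the third index that the relation `phi_mul` calls for. -/
theorem exists_ne_and_ne (l₁ l₂ : OnePoint (ZMod 2)) : ∃ l₃, l₁ ≠ l₃ ∧ l₂ ≠ l₃ := by
  induction l₁ using OnePoint.rec with
  | infty =>
    induction l₂ using OnePoint.rec with
    | infty => exact ⟨(0 : ZMod 2), OnePoint.infty_ne_coe _, OnePoint.infty_ne_coe _⟩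
    | coe l => exact ⟨(l + 1 : ZMod 2), OnePoint.infty_ne_coe _, by simp⟩
  | coe m =>
    induction l₂ using OnePoint.rec with
    | infty => exact ⟨(m + 1 : ZMod 2), by simp, OnePoint.infty_ne_coe _⟩
    | coe l => exact ⟨OnePoint.infty, OnePoint.coe_ne_infty _, OnePoint.coe_ne_infty _⟩

theorem mk_polyPhi_mul_polyPhi_mem (l₁ l₂ : OnePoint (ZMod 2)) :
    modRel (polyPhi l₁) * modRel (polyPhi l₂) ∈ irrSpan := by
  rcases eq_or_ne l₁ l₂ with rfl | h
  · have key : ∀ n k : ZMod 2, (n, k) ≠ (0, 0) →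
        modRel (polyPhi (frac n k)) * modRel (polyPhi (frac n k)) ∈ irrSpan := fun n k h => by
      rw [← map_mul, ← sq, mk_eq_of_mulRel2 (.phi_sq n k h)]
      simp only [map_sum]
      exact Submodule.sum_mem _ fun _ _ => Submodule.sum_mem _ fun _ _ => mk_polyF_mem _ _ _
    induction l₁ using OnePoint.rec with
    | infty => exact key 1 0 (by simp)
    | coe l =>
      have hf : frac l 1 = (l : OnePoint (ZMod 2)) := (if_neg one_ne_zero).trans (by rw [div_one])
      rw [← hf]
      exact key l 1 (by simp)
  · obtain ⟨l₃, h₁, h₂⟩ := exists_ne_and_ne l₁ l₂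
    obtain ⟨a, b, c, habc⟩ := exists_not_stabilizer l₃
    rw [← map_mul, mk_eq_of_mulRel2 (.phi_mul l₁ l₂ l₃ a b c h h₁ h₂ habc), map_add, map_mul]
    exact Submodule.add_mem _ (mk_polyPhi_mem _) (mk_polyF_mul_polyPhi_mem _ _ _ _)

theorem mk_polyPhi_mul_polyPsi_mem (l : OnePoint (ZMod 2)) :
    modRel (polyPhi l) * modRel polyPsi ∈ irrSpan := by
  rw [← map_mul, mk_eq_of_mulRel2 (.phi_psi l), map_add, map_mul]
  exact Submodule.add_mem _ mk_polyPsi_mem (mk_polyF_mul_polyPsi_mem _ _ _)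

theorem mk_polyPsi_mul_polyPsi_mem : modRel polyPsi * modRel polyPsi ∈ irrSpan := by
  rw [← map_mul, ← sq, mk_eq_of_mulRel2 .psi_sq]
  simp only [map_add, map_sum, map_mul]
  refine Submodule.add_mem _ (Submodule.add_mem _ ?_ ?_) ?_
  · exact Submodule.sum_mem _ fun _ _ => Submodule.sum_mem _ fun _ _ => mk_polyF_mem _ _ _
  · exact Submodule.sum_mem _ fun _ _ => Submodule.sum_mem _ fun _ _ =>
      mk_polyF_mul_polyPhi_mem _ _ _ _
  · exact Submodule.sum_mem _ fun _ _ => mk_polyF_mul_polyPhi_mem _ _ _ _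

/-- Multiplication by the f only moves twists around. For φ and ψ the twist is pulled out in front,
leaving a product of two generators that a relation rewrites. -/
theorem mk_X_mul_mem (g : Gen2) {y : MvPolynomial Gen2 ℤ ⧸ relIdeal} (hy : y ∈ irrSpan) :
    modRel (MvPolynomial.X g) * y ∈ irrSpan := by
  have h0 : (0 : ZMod 2).val = 0 := rfl
  have h1 : (1 : ZMod 2).val = 1 := rfl
  cases g with
  | e1 => simpa [polyF, h0, h1] using mk_polyF_mul_mem 1 0 0 hy
  | e2 => simpa [polyF, h0, h1] using mk_polyF_mul_mem 0 1 0 hy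
  | e3 => simpa [polyF, h0, h1] using mk_polyF_mul_mem 0 0 1 hy
  | phi l =>
    change modRel (polyPhi l) * y ∈ _
    refine mul_mem_irrSpan (fun a b c => ?_) (fun a b c l' => ?_) (fun a b c => ?_) hy
    · rw [mul_comm]
      exact mk_polyF_mul_polyPhi_mem _ _ _ _
    · rw [mul_left_comm]
      exact mk_polyF_mul_mem _ _ _ (mk_polyPhi_mul_polyPhi_mem _ _)
    · rw [mul_left_comm]
      exact mk_polyF_mul_mem _ _ _ (mk_polyPhi_mul_polyPsi_mem _)
  | psi =>
    change modRel polyPsi * y ∈ _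
    refine mul_mem_irrSpan (fun a b c => ?_) (fun a b c l' => ?_) (fun a b c => ?_) hy
    · rw [mul_comm]
      exact mk_polyF_mul_polyPsi_mem _ _ _
    · rw [mul_left_comm, mul_comm (modRel polyPsi)]
      exact mk_polyF_mul_mem _ _ _ (mk_polyPhi_mul_polyPsi_mem _)
    · rw [mul_left_comm]
      exact mk_polyF_mul_mem _ _ _ mk_polyPsi_mul_polyPsi_mem

/-- The span contains 1 and is stable under multiplication by each generator, so it is the whole
quotient. -/
theorem mk_mem_irrSpan (q : MvPolynomial Gen2 ℤ) : modRel q ∈ irrSpan := by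
  induction q using MvPolynomial.induction_on with
  | C a =>
    rw [eq_intCast MvPolynomial.C a, map_intCast, ← mul_one (a : MvPolynomial Gen2 ℤ ⧸ relIdeal),
      ← zsmul_eq_mul, ← mk_polyF_zero]
    exact Submodule.smul_mem _ _ (mk_polyF_mem _ _ _)
  | add p q hp hq => rw [map_add]; exact Submodule.add_mem _ hp hq
  | mul_X p g hp => rw [map_mul, mul_comm]; exact mk_X_mul_mem g hp

theorem relIdeal_le_ker : relIdeal ≤ RingHom.ker
    (MvPolynomial.aeval Gen2.val : MvPolynomial Gen2 ℤ →ₐ[ℤ] RepRing (unitri 4 2)) :=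
  Ideal.span_le.2 fun _ h => aeval_mulRel2 h

/-- Modulo the relations, q is a combination of the `irrPoly t`. If q maps to 0, so does the
combination; its image is a relation between distinct irreducible classes, and all coefficients
vanish. -/
theorem ker_aeval_gen2 : RingHom.ker
    (MvPolynomial.aeval Gen2.val : MvPolynomial Gen2 ℤ →ₐ[ℤ] RepRing (unitri 4 2)) =
      relIdeal := by
  refine le_antisymm (fun q hq => ?_) relIdeal_le_ker
  obtain ⟨n, hn⟩ := (Submodule.mem_span_range_iff_exists_fun ℤ).1 (mk_mem_irrSpan q)
  have h1 : ∑ t, n t • irrPoly t - q ∈ relIdeal := by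
    rw [← Ideal.Quotient.eq, ← hn]
    simp only [map_sum, map_zsmul]
  have h2 : MvPolynomial.aeval Gen2.val (∑ t, n t • irrPoly t - q) = 0 := relIdeal_le_ker h1
  rw [map_sub, (RingHom.mem_ker).1 hq, sub_zero, map_sum] at h2
  simp only [map_zsmul, aeval_irrPoly] at h2
  have h3 := irrRep_isRegularFamily.eq_zero_of_sum_cls h2
  simp only [h3, zero_smul, Finset.sum_const_zero] at hn
  exact Ideal.Quotient.eq_zero_iff_mem.1 hn.symm

theorem adjoin_gen2 : Algebra.adjoin ℤ (Set.range Gen2.val) = ⊤ := by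
  rw [Algebra.adjoin_range_eq_range_aeval, eq_top_iff]
  rintro x -
  obtain ⟨n, rfl⟩ :=
    (Submodule.mem_span_range_iff_exists_fun ℤ).1 (irrRep_isRegularFamily.mem_span x)
  refine ⟨∑ t, n t • irrPoly t, ?_⟩
  change MvPolynomial.aeval Gen2.val (∑ t, n t • irrPoly t) = _
  simp only [map_sum, map_zsmul, aeval_irrPoly]

end Presentation

/-! ### Irreducibility, faithfulness and orbits for p = 2. -/

section TwoMisc

open CRep

/-- Homomorphisms to ℂˣ factor through the abelianization, and a finite abelian group is isomorphic
to its dual over ℂ. -/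
theorem nonempty_hom_mulEquiv_abelianization :
    Nonempty ((unitri 4 2 →* ℂˣ) ≃* Abelianization (unitri 4 2)) := by
  have : Finite (Abelianization (unitri 4 2)) :=
    Finite.of_surjective _ (QuotientGroup.mk'_surjective _)
  obtain ⟨e⟩ := CommGroup.monoidHom_mulEquiv_of_hasEnoughRootsOfUnity
    (Abelianization (unitri 4 2)) ℂ
  have e' : (unitri 4 2 →* ℂˣ) ≃* (Abelianization (unitri 4 2) →* ℂˣ) :=
    { Abelianization.lift with
      map_mul' := fun f g => Abelianization.hom_ext _ _ (MonoidHom.ext fun x => rfl) }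
  exact ⟨e'.trans e⟩

theorem irred_of_iso {G : Type} [Group G] [Fintype G] {A B : CRep G} (h : A.Iso B)
    (hA : A.Irred) : B.Irred := by
  refine irred_of_homDim_self ?_
  rw [← homDim_congr h h]
  have : A.ρ.IsIrreducible := hA
  exact Representation.IsIrreducible.finrank_intertwiningMap_self A.ρ

theorem phi2_irred (l : OnePoint (ZMod 2)) : (phi2 l).Irred := by
  induction l using OnePoint.rec with
  | infty =>
    exact irred_of_iso (fRep_zero_tensor _) (irrRep_isRegularFamily.irred (.midInf 0 1))
  | coe l =>
    exact irred_of_iso (fRep_zero_tensor _) (irrRep_isRegularFamily.irred (.mid 0 1 l))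

theorem psi2_irred : psi2.Irred :=
  irred_of_iso (fRep_zero_tensor _) (irrRep_isRegularFamily.irred (.top 0 1))

/-- An element acting trivially has character value 4, and the character table takes this value only
at the identity. -/
theorem psi2_faithful : psi2.Faithful := by
  have hker : ∀ g, psi2.ρ g = 1 → g = 1 := fun g hg => by
    have h1 : psi2.char g = 4 := by
      have : psi2.char g = psi2.char 1 :=
        congrArg (LinearMap.trace ℂ _) (hg.trans (map_one psi2.ρ).symm)
      rw [this, char_one, degree_psi2]
      norm_num
    rw [← mk4_ent g, char_psi2] at h1
    have h2 : chiPsi (ent g 0 1) (ent g 0 2) (ent g 0 3) (ent g 1 2) (ent g 1 3)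
        (ent g 2 3) = 4 := by
      exact_mod_cast h1
    rw [← mk4_ent g, ← mk4_zero, mk4_inj]
    generalize ent g 0 1 = u at *
    generalize ent g 0 2 = x at *
    generalize ent g 0 3 = z at *
    generalize ent g 1 2 = v at *
    generalize ent g 1 3 = y at *
    generalize ent g 2 3 = w at *
    clear h1 hg
    revert u x z v y w
    decide
  intro g h hgh
  have h1 : psi2.ρ (g * h⁻¹) = 1 := by
    rw [map_mul, hgh, ← map_mul, mul_inv_cancel, map_one]
  exact mul_inv_eq_one.1 (hker _ h1)

theorem existsUnique_phi2 {A : CRep (unitri 4 2)} (hA : A.Irred) (hd : A.degree = 2) :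
    ∃! l, ∃ a b c : ZMod 2, A.Iso ((fRep a b c).tensor (phi2 l)) := by
  -- The index in the list of a twist of φ_ℓ still determines ℓ, whence the uniqueness.
  have key : ∀ (a b c : ZMod 2) (l : OnePoint (ZMod 2)), ∃ t, OnePoint.rec (t = .midInf a 1)
      (fun l => t = IrrIndex.mid (a * l + c) 1 l) l ∧
      ((fRep a b c).tensor (phi2 l)).Iso (irrRep t) := fun a b c l => by
    induction l using OnePoint.rec with
    | infty => exact ⟨_, rfl, fRep_tensor_phi_infty a b c 1⟩
    | coe l => exact ⟨_, rfl, fRep_tensor_phi_coe a b c 1 l⟩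
  obtain ⟨t, ht⟩ := irrRep_isRegularFamily.exists_iso hA
  have hdt := ht.degree_eq
  rw [hd, irrRep_degree] at hdt
  refine existsUnique_of_exists_of_unique ?_ ?_
  · cases t with
    | lin a b c => simp at hdt
    | mid a i l =>
      rw [irrRep, zmodTwo_units i] at ht
      exact ⟨l, 0, 0, a, ht⟩
    | midInf a i =>
      rw [irrRep, zmodTwo_units i] at ht
      exact ⟨OnePoint.infty, a, 0, 0, ht⟩
    | top a i => simp at hdt
  · rintro l l' ⟨a, b, c, h⟩ ⟨a', b', c', h'⟩
    obtain ⟨s, hs, hs'⟩ := key a b c l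
    obtain ⟨s', ht, ht'⟩ := key a' b' c' l'
    have hss : s = s' :=
      irrRep_isRegularFamily.eq_of_iso (hs'.symm.trans (h.symm.trans (h'.trans ht')))
    induction l using OnePoint.rec with
    | infty =>
      induction l' using OnePoint.rec with
      | infty => rfl
      | coe l' =>
        change s = _ at hs
        change s' = _ at ht
        simp [hs, ht] at hss
    | coe l =>
      induction l' using OnePoint.rec with
      | infty =>
        change s = _ at hs
        change s' = _ at ht
        simp [hs, ht] at hss
      | coe l' =>
        change s = _ at hs
        change s' = _ at ht
        rw [hs, ht, IrrIndex.mid.injEq] at hss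
        rw [hss.2.2]

theorem exists_iso_psi2 {A : CRep (unitri 4 2)} (hA : A.Irred) (hd : A.degree = 4) :
    ∃ a b c : ZMod 2, A.Iso ((fRep a b c).tensor psi2) := by
  obtain ⟨t, ht⟩ := irrRep_isRegularFamily.exists_iso hA
  have hdt := ht.degree_eq
  rw [hd, irrRep_degree] at hdt
  cases t with
  | lin a b c => simp at hdt
  | mid a i l => simp at hdt
  | midInf a i => simp at hdt
  | top a i =>
    rw [irrRep, zmodTwo_units i] at ht
    exact ⟨0, a, 0, ht⟩

end TwoMisc

theorem mainTheorem12 :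
    -- the group of upper unitriangular matrices and its irreducible representations, any prime `p`
    (∀ (p : ℕ) [Fact p.Prime],
      -- it is a Sylow `p`-subgroup of `GL(4, p)`
      (∃ P : Sylow p (GL (Fin 4) (ZMod p)), P.toSubgroup = unitri 4 p) ∧
      -- the number of conjugacy classes
      Nat.card (ConjClasses (unitri 4 p)) = p * (p - 1) + p * (p + 1) * (p - 1) + p ^ 3 ∧
      -- the `f_{(a,b,c)}` are the elements of `Hom(G, ℂˣ)`
      Function.Bijective (fun t : ZMod p × ZMod p × ZMod p => linChar t.1 t.2.1 t.2.2) ∧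
      (∀ a b c a' b' c' : ZMod p,
        ((fRep a b c).tensor (fRep a' b' c')).Iso (fRep (a + a') (b + b') (c + c'))) ∧
      -- `φ_{i,ℓ}` has kernel `N_ℓ` and restricts to `φ_i` on `H_∞`, respectively on `H_0`
      (∀ (i : (ZMod p)ˣ) (n k : ZMod p), (n, k) ≠ (0, 0) → ∀ g : unitri 4 p,
        (phi (i : ZMod p) (frac n k)).ρ g = 1 ↔
          ∃ x y z : ZMod p, g = mk4 (n * x) (n * y) z 0 (-(k * y)) (k * x)) ∧
      (∀ (i : (ZMod p)ˣ) (l : ZMod p),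
        ((phiInf (i : ZMod p) l).pullback inclInf).Iso (heisRep (i : ZMod p))) ∧
      (∀ (i : (ZMod p)ˣ) (m : ZMod p),
        ((phiZero (i : ZMod p) m).pullback inclZero).Iso (heisRep (i : ZMod p))) ∧
      (∀ (i : (ZMod p)ˣ) (l : ZMod p), l ≠ 0 →
        (phiInf (i : ZMod p) l).Iso (phiZero (i * l) l⁻¹)) ∧
      -- degrees, stabilizers and orbit sizes under tensoring with the `f_{(a,b,c)}`
      (∀ a b c : ZMod p, (fRep a b c).degree = 1) ∧
      (∀ (i : (ZMod p)ˣ) (l : OnePoint (ZMod p)), (phi (i : ZMod p) l).degree = p) ∧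
      (∀ k : (ZMod p)ˣ, (psiRep (k : ZMod p)).degree = p ^ 2) ∧
      (∀ (i : (ZMod p)ˣ) (n k : ZMod p), (n, k) ≠ (0, 0) → ∀ a b c : ZMod p,
        ((fRep a b c).tensor (phi (i : ZMod p) (frac n k))).Iso (phi (i : ZMod p) (frac n k)) ↔
          ∃ x y : ZMod p, a = k * x ∧ b = y ∧ c = -(n * x)) ∧
      (∀ (i : (ZMod p)ˣ) (l : OnePoint (ZMod p)), (charOrbit (phi (i : ZMod p) l)).ncard = p) ∧
      (∀ (k : (ZMod p)ˣ) (a b c : ZMod p),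
        ((fRep a b c).tensor (psiRep (k : ZMod p))).Iso (psiRep (k : ZMod p)) ↔ b = 0) ∧
      (∀ k : (ZMod p)ˣ, (charOrbit (psiRep (k : ZMod p))).ncard = p) ∧
      -- the complete list of irreducible representations, without repetition
      (∀ t : IrrIndex p, (irrRep t).Irred) ∧
      (∀ t t' : IrrIndex p, (irrRep t).Iso (irrRep t') → t = t') ∧
      (∀ A : CRep (unitri 4 p), A.Irred → ∃ t : IrrIndex p, A.Iso (irrRep t))) ∧
    -- the representation ring for `p = 2`: generators
    Nonempty ((unitri 4 2 →* ℂˣ) ≃* Abelianization (unitri 4 2)) ∧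
    (∀ l, (phi2 l).Irred ∧ (phi2 l).degree = 2) ∧
    (psi2.Irred ∧ psi2.degree = 4 ∧ psi2.Faithful) ∧
    Algebra.adjoin ℤ (Set.range Gen2.val) = ⊤ ∧
    -- the action on irreducible representations of degree 2 and 4
    (∀ A : CRep (unitri 4 2), A.Irred → A.degree = 2 →
      ∃! l, ∃ a b c : ZMod 2, A.Iso ((fRep a b c).tensor (phi2 l))) ∧
    (∀ l, (charOrbit (phi2 l)).ncard = 2) ∧
    (∀ A : CRep (unitri 4 2), A.Irred → A.degree = 4 →
      ∃ a b c : ZMod 2, A.Iso ((fRep a b c).tensor psi2)) ∧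
    (charOrbit psi2).ncard = 2 ∧
    -- the multiplicative relations
    (∀ a b c a' b' c' : ZMod 2,
      (fRep a b c).cls * (fRep a' b' c').cls = (fRep (a + a') (b + b') (c + c')).cls) ∧
    (∀ n k x y : ZMod 2, (n, k) ≠ (0, 0) →
      (fRep (k * x) y (n * x)).cls * (phi2 (frac n k)).cls = (phi2 (frac n k)).cls) ∧
    (∀ x y : ZMod 2, (fRep x 0 y).cls * psi2.cls = psi2.cls) ∧
    (∀ n k : ZMod 2, (n, k) ≠ (0, 0) →
      (phi2 (frac n k)).cls ^ 2 =
        ∑ a : ZMod 2, ∑ b : ZMod 2, (fRep (k * a) b (-(n * a))).cls) ∧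
    (∀ (l₁ l₂ l₃ : OnePoint (ZMod 2)) (a b c : ZMod 2), l₁ ≠ l₂ → l₁ ≠ l₃ → l₂ ≠ l₃ →
      ¬ ((fRep a b c).tensor (phi2 l₃)).Iso (phi2 l₃) →
      (phi2 l₁).cls * (phi2 l₂).cls = (phi2 l₃).cls + (fRep a b c).cls * (phi2 l₃).cls) ∧
    psi2.cls ^ 2 =
      (∑ a : ZMod 2, ∑ b : ZMod 2, (fRep a 0 b).cls) +
        (∑ a : ZMod 2, ∑ l : ZMod 2, (fRep 0 0 a).cls * (phi2 l).cls) +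
        ∑ a : ZMod 2, (fRep a 0 0).cls * (phi2 OnePoint.infty).cls ∧
    (∀ l, (phi2 l).cls * psi2.cls = psi2.cls + (fRep 0 1 0).cls * psi2.cls) ∧
    -- these relations present the ring on the seven generators
    RingHom.ker (MvPolynomial.aeval Gen2.val : MvPolynomial Gen2 ℤ →ₐ[ℤ] RepRing (unitri 4 2)) =
      Ideal.span {q : MvPolynomial Gen2 ℤ | MulRel2 q} ∧
    -- exterior powers
    ((phi2 (0 : ZMod 2)).extPow 2).cls = (fRep 1 1 0).cls ∧
    ((phi2 (1 : ZMod 2)).extPow 2).cls = (fRep 1 1 1).cls ∧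
    ((phi2 OnePoint.infty).extPow 2).cls = (fRep 0 1 1).cls ∧
    (psi2.extPow 2).cls =
      (fRep 0 0 1).cls * (phi2 (0 : ZMod 2)).cls + (fRep 0 0 1).cls * (phi2 (1 : ZMod 2)).cls +
        (fRep 1 0 0).cls * (phi2 OnePoint.infty).cls ∧
    (psi2.extPow 3).cls = (fRep 0 1 0).cls * psi2.cls ∧
    (psi2.extPow 4).cls = (fRep 0 1 0).cls := by
  refine ⟨fun p _ => ⟨exists_unitri_sylow p, card_conjClasses, linChar_bijective, fRep_tensor_fRep,
    fun i n k h g => phi_eq_one_iff i h g, fun i l => phiInf_pullback (i : ZMod p) l,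
    fun i m => phiZero_pullback (i : ZMod p) m, fun i l h => phiInf_iso_phiZero i h, degree_fRep,
    fun i l => degree_phi (i : ZMod p) l, fun k => degree_psiRep (k : ZMod p),
    fun i n k h a b c => stabilizer_phi_frac i h a b c, ncard_charOrbit_phi,
    fun k a b c => stabilizer_psiRep a b c k, ncard_charOrbit_psiRep,
    irrRep_isRegularFamily.irred, fun _ _ h => irrRep_isRegularFamily.eq_of_iso h,
    fun _ h => irrRep_isRegularFamily.exists_iso h⟩, nonempty_hom_mulEquiv_abelianization,
    fun l => ⟨phi2_irred l, degree_phi2 l⟩, ⟨psi2_irred, degree_psi2, psi2_faithful⟩,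
    adjoin_gen2, fun _ hA hd => existsUnique_phi2 hA hd, fun l => ncard_charOrbit_phi 1 l,
    fun _ hA hd => exists_iso_psi2 hA hd, ncard_charOrbit_psiRep 1, cls_fRep_mul,
    cls_fRep_mul_phi2, cls_fRep_mul_psi2, cls_phi2_sq, cls_phi2_mul, cls_psi2_sq,
    cls_phi2_mul_psi2, ker_aeval_gen2, phi2_coe_extPow_two 0, phi2_coe_extPow_two 1,
    phi2_infty_extPow_two, psi2_extPow_two, psi2_extPow_three, psi2_extPow_four⟩
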